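/- Let $N,p\ge 1$ be integers and let $0<\overline H_1\le\overline H_2\le\dots\le\overline H_N\le 1$. Let $X=\{X(t),t\in\mathbb R^N\}$ be a real-valued centered Gaussian random field satisfying the following two conditions. (D1) There are constants $\delta_0>0$ and $c\ge 1$ such that for all $s,t\in[0,1]^N$ with $|s-t|\le\delta_0$, $$c^{-1}\sum_{j=1}^N|s_j-t_j|^{2\overline H_j}\le \mathbb E\big[(X(t)-X(s))^2\big]\le c\sum_{j=1}^N|s_j-t_j|^{2\overline H_j}.$$ (D2) For every $\varepsilon\in(0,1)$ there is a constant $c'>0$ such that for all $u,t\in[\varepsilon,1]^N$, $$\operatorname{Var}\big(X(u)\,\big|\,X(t)\big)\ge c'\sum_{j=1}^N|u_j-t_j|^{2\overline H_j}\quad\text{a.s.}$$ Let $\mathbf X(t)=(X_1(t),\dots,X_p(t))$, $t\in\mathbb R^N$, where $X_1,\dots,X_p$ are independent copies of $X$, and assume that almost surely $t\mapsto\mathbf X(t)$ is continuous on $[0,1]^N$. For $x\in\mathbb R^p$ let $\mathbf X^{-1}(x)=\{t\in[0,1]^N:\mathbf X(t)=x\}$ be the level set in the unit cube, and let $\dim$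 denote Hausdorff dimension with respect to the Euclidean metric. Then: (i) If $\sum_{j=1}^N 1/\overline H_j<p$, then for every $x\in\mathbb R^p\setminus\{0\}$, $\mathbf X^{-1}(x)=\emptyset$ almost surely. (ii) If $\sum_{j=1}^N 1/\overline H_j>p$, then for every $x\in\mathbb R^p$, with positive probability (that is, on some measurable event of positive probability), $$\dim\mathbf X^{-1}(x)=\min_{1\le k\le N}\Big\{\sum_{j=1}^k\frac{\overline H_k}{\overline H_j}+N-k-\overline H_k\,p\Big\}.$$ -/

import Mathlib

open MeasureTheory ProbabilityTheory

/-- The closed cube `[a, b]^N` in `ℝ^N`. -/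
def cube (N : ℕ) (a b : ℝ) : Set (EuclideanSpace ℝ (Fin N)) :=
  {t | ∀ j, t j ∈ Set.Icc a b}

/-- A real-valued centered Gaussian random field `X = {X(t), t ∈ ℝ^N}` on the probability space
`(Ω, P)`. -/
structure IsCenteredGaussianField {N : ℕ} {Ω : Type*} [MeasurableSpace Ω]
    (X : EuclideanSpace ℝ (Fin N) → Ω → ℝ) (P : Measure Ω) : Prop where
  measurable : ∀ t, Measurable (X t)
  gaussian : IsGaussianProcess X P
  centered : ∀ t, ∫ ω, X t ω ∂P = 0

/-- The real random fields `Y₁, …, Y_p` on `(Ω, P)` are independent copies of the random field `X`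
on `(Ω₀, P₀)`: each `Y_i`, as a random element of `ℝ^(ℝ^N)` with the product σ-algebra, has the
law of `X` (that is, the same finite-dimensional distributions), and the `Y_i` are independent. -/
structure AreIndependentCopies {N p : ℕ} {Ω₀ Ω : Type*} [MeasurableSpace Ω₀] [MeasurableSpace Ω]
    (Y : Fin p → EuclideanSpace ℝ (Fin N) → Ω → ℝ) (P : Measure Ω)
    (X : EuclideanSpace ℝ (Fin N) → Ω₀ → ℝ) (P₀ : Measure Ω₀) : Prop where
  measurable : ∀ i t, Measurable (Y i t)
  identDistrib : ∀ i, IdentDistrib (fun ω t => Y i t ω) (fun ω t => X t ω) P P₀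
  indep : iIndepFun (fun i ω t => Y i t ω) P

/-- The vector-valued field `𝐗(t) = (Y₁(t), …, Y_p(t)) ∈ ℝ^p`. -/
def vectorField {N p : ℕ} {Ω : Type*} (Y : Fin p → EuclideanSpace ℝ (Fin N) → Ω → ℝ)
    (t : EuclideanSpace ℝ (Fin N)) (ω : Ω) : EuclideanSpace ℝ (Fin p) :=
  WithLp.toLp 2 (fun i => Y i t ω)

/-- The level set `{t ∈ [0,1]^N : 𝐗(t) = x}` of the sample function `t ↦ 𝐗(t, ω)`. -/
def levelSet {N p : ℕ} {Ω : Type*} (Y : Fin p → EuclideanSpace ℝ (Fin N) → Ω → ℝ)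
    (x : EuclideanSpace ℝ (Fin p)) (ω : Ω) : Set (EuclideanSpace ℝ (Fin N)) :=
  {t | t ∈ cube N 0 1 ∧ vectorField Y t ω = x}

/-- The anisotropic variogram scale `∑_j |s_j - t_j|^(2 H_j)`. -/
noncomputable def anisoScale {N : ℕ} (H : Fin N → ℝ) (s t : EuclideanSpace ℝ (Fin N)) : ℝ :=
  ∑ j, |s j - t j| ^ (2 * H j)

/-- Condition (D1): two-sided local comparison of `E[(X(t) - X(s))²]` with the scale
`∑_j |s_j - t_j|^(2 H_j)` on `[0,1]^N`. -/
def ConditionD1 {N : ℕ} {Ω : Type*} [MeasurableSpace Ω] (H : Fin N → ℝ)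
    (X : EuclideanSpace ℝ (Fin N) → Ω → ℝ) (P : Measure Ω) : Prop :=
  ∃ δ c : ℝ, 0 < δ ∧ 1 ≤ c ∧ ∀ s ∈ cube N 0 1, ∀ t ∈ cube N 0 1, ‖s - t‖ ≤ δ →
    c⁻¹ * anisoScale H s t ≤ ∫ ω, (X t ω - X s ω) ^ 2 ∂P ∧
    ∫ ω, (X t ω - X s ω) ^ 2 ∂P ≤ c * anisoScale H s t

/-- Condition (D2): for every `ε ∈ (0,1)`, the conditional variance of `X(u)` given (the
σ-algebra generated by) `X(t)` is at least a constant times `∑_j |u_j - t_j|^(2 H_j)`, for all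
`u, t ∈ [ε,1]^N`. -/
def ConditionD2 {N : ℕ} {Ω : Type*} [MeasurableSpace Ω] (H : Fin N → ℝ)
    (X : EuclideanSpace ℝ (Fin N) → Ω → ℝ) (P : Measure Ω) : Prop :=
  ∀ ε ∈ Set.Ioo (0 : ℝ) 1, ∃ c : ℝ, 0 < c ∧ ∀ u ∈ cube N ε 1, ∀ t ∈ cube N ε 1,
    ∀ᵐ ω ∂P, c * anisoScale H u t ≤
      Var[X u; P | MeasurableSpace.comap (X t) (inferInstance : MeasurableSpace ℝ)] ω

/-- `min_{1 ≤ k ≤ N} (∑_{j ≤ k} H_k / H_j + N - k - H_k p)`; the element `k : Fin N` stands for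
the index `k + 1` of the formula. -/
noncomputable def levelDim {N : ℕ} [NeZero N] (H : Fin N → ℝ) (p : ℕ) : ℝ :=
  Finset.univ.inf' Finset.univ_nonempty fun k : Fin N =>
    (∑ j ∈ Finset.Iic k, H k / H j) + ((N : ℝ) - ((k : ℕ) + 1 : ℝ)) - H k * (p : ℝ)

/-! ### One- and two-dimensional Gaussian estimates -/

/-! The upper bounds are first-moment counts of boxes. For exponents `h j ≤ H j`, cut the cube into
boxes with sides about `2 ^ (-n / h j)`. By (D1) the increments of the field inside a box have
standard deviation of order `2 ^ (-n)`, and chaining (`ae_eventually_abs_sub_gridPoint_le`) bounds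
the oscillation by a multiple of `ρ ^ n` for any `ρ > 1 / 2`. A box where the variance is not small
meets the level set only if the field at a reference point is within `C * ρ ^ n` of `x`, which has
probability of order `ρ ^ (n * p)`. About `2 ^ (n * ∑ 1 / h j)` boxes are available, so
`ae_exists_grid_cover` controls the number that are hit. With `h = H` and `∑ 1 / H j < p`,
eventually none is hit. With `h j = min (H j) (H k)`, where `k` attains the minimum in `levelDim`,
all boxes have diameter at most of order `2 ^ (-n / H k)`, and the resulting exponent is `H k * (∑ 1
/ h j - p) = levelDim H p`. Points of zero variance escape the count, but (D1) isolates them, and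
there the field is almost surely zero.

The lower bound is a second-moment argument on `[1/2, 1]^N`. The random measures with density `r ^
(-p)` on the set where every coordinate of the field is within `r` of `x` have expected mass bounded
below. By (D2) and linear regression, the probability that both `s` and `t` are near the level is at
most a constant times `r ^ (2 * p) * anisoScale H s t ^ (-p / 2)`, so the expected `g`-energy is
bounded uniformly in `r` once `|s - t| ^ (-g) * anisoScale H s t ^ (-p / 2)` is integrable. Sharing
the two singularities among the coordinates turns this into a linear program, solvable for `g <
levelDim H p` (`exists_exponents`). Paley–Zygmund and Markov give mass bounded below and energy
bounded above along infinitely many scales, with probability at least some `q`;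
`hausdorffMeasure_ne_zero_of_energy_le` then gives positive Hausdorff measure. Since `q` does not
depend on `g`, one can let `g` increase to `levelDim H p`. -/

lemma gaussianReal_interval_le (m : ℝ) {v : NNReal} (hv : v ≠ 0) (x r : ℝ) :
    gaussianReal m v {y | |y - x| ≤ r} ≤ ENNReal.ofReal (2 * r / √(v : ℝ)) := by
  have hset : {y : ℝ | |y - x| ≤ r} = Set.Icc (x - r) (x + r) := by
    ext y
    simp only [Set.mem_ofPred_eq, abs_le, Set.mem_Icc]
    constructor <;> rintro ⟨h1, h2⟩ <;> constructor <;> linarith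
  have hv0 : (0 : ℝ) < v := by positivity
  rw [gaussianReal_apply m hv, hset]
  calc ∫⁻ y in Set.Icc (x - r) (x + r), gaussianPDF m v y
      ≤ ∫⁻ _ in Set.Icc (x - r) (x + r), ENNReal.ofReal (1 / √(v : ℝ)) := by
        refine lintegral_mono fun y => ENNReal.ofReal_le_ofReal ?_
        rw [gaussianPDFReal, ← one_div]
        have h1 : Real.exp (-(y - m) ^ 2 / (2 * v)) ≤ 1 := by
          rw [Real.exp_le_one_iff]
          exact div_nonpos_of_nonpos_of_nonneg (by nlinarith [sq_nonneg (y - m)]) (by positivity)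
        have h2 : 1 / √(2 * Real.pi * v) ≤ 1 / √(v : ℝ) := by
          apply one_div_le_one_div_of_le (by positivity)
          apply Real.sqrt_le_sqrt
          nlinarith [Real.pi_gt_three]
        calc _ ≤ 1 / √(2 * Real.pi * v) * 1 := by gcongr
          _ ≤ _ := by simpa using h2
    _ = ENNReal.ofReal (2 * r / √(v : ℝ)) := by
        rw [lintegral_const, Measure.restrict_apply_univ, Real.volume_Icc,
          ← ENNReal.ofReal_mul (by positivity)]
        congr 1
        ring

lemma le_gaussianReal_interval {v : NNReal} {a b : ℝ} (ha : 0 < a) (hav : a ≤ v) (hvb : v ≤ b)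
    (x : ℝ) {r : ℝ} (hr : r ≤ 1) :
    ENNReal.ofReal (2 * r * ((√(2 * Real.pi * b))⁻¹ * Real.exp (-(|x| + 1) ^ 2 / (2 * a)))) ≤
      gaussianReal 0 v {y | |y - x| ≤ r} := by
  have hset : {y : ℝ | |y - x| ≤ r} = Set.Icc (x - r) (x + r) := by
    ext y
    simp only [Set.mem_ofPred_eq, abs_le, Set.mem_Icc]
    constructor <;> rintro ⟨h1, h2⟩ <;> constructor <;> linarith
  have hv0 : (0 : ℝ) < v := ha.trans_le hav
  have hv : v ≠ 0 := by rintro rfl; simp at hv0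
  rw [gaussianReal_apply 0 hv]
  have hm : MeasurableSet {y : ℝ | |y - x| ≤ r} := by rw [hset]; exact measurableSet_Icc
  calc _ = ∫⁻ _ in {y : ℝ | |y - x| ≤ r},
        ENNReal.ofReal ((√(2 * Real.pi * b))⁻¹ * Real.exp (-(|x| + 1) ^ 2 / (2 * a))) := by
        rw [lintegral_const, Measure.restrict_apply_univ, hset, Real.volume_Icc,
          ← ENNReal.ofReal_mul (by positivity)]
        congr 1
        ring
    _ ≤ _ := by
        refine setLIntegral_mono' hm fun y hy => ENNReal.ofReal_le_ofReal ?_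
        rw [gaussianPDFReal]
        have h1 : |y| ≤ |x| + 1 := by
          have := abs_sub_abs_le_abs_sub y x
          have h2 : |y - x| ≤ r := hy
          linarith
        have h2 : (y - 0) ^ 2 ≤ (|x| + 1) ^ 2 := by
          rw [sub_zero, ← sq_abs y]
          gcongr
        have h3 : -(|x| + 1) ^ 2 / (2 * a) ≤ -(y - 0) ^ 2 / (2 * (v : ℝ)) := by
          rw [neg_div, neg_div, neg_le_neg_iff]
          gcongr
        gcongr

/-- Markov's inequality for the `q`-th absolute moment after scaling to the standard Gaussian.
Polynomial decay of arbitrary order suffices: in the chaining, `q` is taken large enough to beat the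
number of boxes. -/
lemma gaussianReal_tail_le (q : ℕ) : ∃ M : ENNReal, M ≠ ⊤ ∧ ∀ (v : NNReal) (σ l : ℝ), 0 < l →
    √(v : ℝ) ≤ σ → gaussianReal 0 v {y | l ≤ |y|} ≤ M * ENNReal.ofReal ((σ / l) ^ q) := by
  refine ⟨∫⁻ y, ‖y‖ₑ ^ q ∂(gaussianReal 0 1), ?_, ?_⟩
  · have h := (memLp_id_gaussianReal (μ := 0) (v := 1) (q : NNReal)).eLpNorm_lt_top
    rcases Nat.eq_zero_or_pos q with rfl | hq
    · simp
    · have := lintegral_rpow_enorm_lt_top_of_eLpNorm_lt_top (p := ((q : NNReal) : ENNReal))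
        (by simp; omega) (by simp) h
      simpa using this.ne
  · intro v σ l hl hσ
    have hmap : gaussianReal 0 v = (gaussianReal 0 1).map (√(v : ℝ) * ·) := by
      rw [gaussianReal_map_const_mul]
      congr 1
      · simp
      · ext; simp
    have hms : MeasurableSet {y : ℝ | l ≤ |y|} :=
      measurableSet_le measurable_const measurable_id.norm
    rw [hmap, Measure.map_apply (by fun_prop) hms]
    have hle : ((√(v : ℝ) * ·) ⁻¹' {y : ℝ | l ≤ |y|}) ⊆
        {y | ENNReal.ofReal (l ^ q) ≤ ENNReal.ofReal (σ ^ q) * ‖y‖ₑ ^ q} := by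
      intro y hy
      simp only [Set.mem_preimage, Set.mem_ofPred_eq, abs_mul, abs_of_nonneg (Real.sqrt_nonneg _)]
        at hy ⊢
      rw [Real.enorm_eq_ofReal_abs, ← ENNReal.ofReal_pow (abs_nonneg _),
        ← ENNReal.ofReal_mul (pow_nonneg ((Real.sqrt_nonneg _).trans hσ) _), ← mul_pow]
      gcongr
      exact hy.trans (by gcongr)
    refine (measure_mono hle).trans ((meas_ge_le_lintegral_div (by fun_prop) (by simp [hl])
      (by simp)).trans ?_)
    rw [lintegral_const_mul _ (by fun_prop), div_pow, ENNReal.ofReal_div_of_pos (by positivity),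
      mul_comm, mul_div_assoc]

/-! ### Linear regression and the two-point estimate. -/

section Regression

variable {Ω : Type*} [MeasurableSpace Ω] {P : Measure Ω}

/-- The variance of the residual in the linear regression of `V` on `U` dominates any constant
lower bound for the conditional variance of `V` given `U`. -/
lemma regression_of_hasGaussianLaw {U V : Ω → ℝ} (hUm : Measurable U) (hVm : Measurable V)
    (h : HasGaussianLaw (fun ω => (U ω, V ω)) P) (hV : ∫ ω, V ω ∂P = 0) (hU : ∫ ω, U ω ∂P = 0)
    (hvar : Var[U; P] ≠ 0) {c : ℝ}
    (hc : ∀ᵐ ω ∂P, c ≤ Var[V; P | MeasurableSpace.comap U (inferInstance : MeasurableSpace ℝ)] ω) :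
    ∃ b : ℝ, IndepFun U (fun ω => V ω - b * U ω) P ∧
      HasGaussianLaw (fun ω => V ω - b * U ω) P ∧ c ≤ Var[fun ω => V ω - b * U ω; P] := by
  have : IsProbabilityMeasure P := h.isProbabilityMeasure
  have hU2 : MemLp U 2 P := h.fst.memLp_two
  have hV2 : MemLp V 2 P := h.snd.memLp_two
  set b : ℝ := cov[U, V; P] / Var[U; P] with hb
  set Z : Ω → ℝ := fun ω => V ω - b * U ω with hZ
  have hZm : Measurable Z := by fun_prop
  have hUZ : HasGaussianLaw (fun ω => (U ω, Z ω)) P := by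
    have := h.map_fun ((ContinuousLinearMap.fst ℝ ℝ ℝ).prod
      (ContinuousLinearMap.snd ℝ ℝ ℝ - b • ContinuousLinearMap.fst ℝ ℝ ℝ))
    simpa using this
  have hZ2 : MemLp Z 2 P := hUZ.snd.memLp_two
  have hcov : cov[U, Z; P] = 0 := by
    have h1 : Z = V - b • U := by ext; simp [hZ]
    rw [h1, covariance_sub_right hU2 hV2 (hU2.const_smul b), covariance_smul_right,
      covariance_self hU2.aemeasurable, hb]
    field_simp
    simp
  have hind := hUZ.indepFun_of_covariance_eq_zero hcov
  refine ⟨b, hind, hUZ.snd, ?_⟩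
  have hEZ : ∫ ω, Z ω ∂P = 0 := by
    simp only [hZ]
    rw [integral_sub h.snd.integrable (h.fst.integrable.const_mul b), integral_const_mul, hU, hV]
    simp
  have hm : MeasurableSpace.comap U (inferInstance : MeasurableSpace ℝ) ≤ ‹MeasurableSpace Ω› :=
    hUm.comap_le
  have hce : P[V | MeasurableSpace.comap U inferInstance] =ᵐ[P] fun ω => b * U ω := by
    have h1 : V = (fun ω => b * U ω) + Z := by ext; simp [hZ]
    have h2 : P[Z | MeasurableSpace.comap U inferInstance] =ᵐ[P] fun _ => P[Z] :=
      condExp_indep_eq hZm.comap_le hm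
        (comap_measurable Z).stronglyMeasurable hind.symm
    have h3 : P[(fun ω => b * U ω) | MeasurableSpace.comap U inferInstance] = fun ω => b * U ω :=
      condExp_of_stronglyMeasurable hm
        ((comap_measurable U).const_mul b).stronglyMeasurable (h.fst.integrable.const_mul b)
    have h4 := condExp_add (m := MeasurableSpace.comap U inferInstance)
      (h.fst.integrable.const_mul b) hUZ.snd.integrable
    rw [← h1] at h4
    filter_upwards [h4, h2] with ω w1 w2
    rw [w1, Pi.add_apply, w2, h3, hEZ, add_zero]
  -- The conditional mean of `V` is `b * U`, so the conditional variance averages to the variance of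
  -- the residual `Z`.
  have hint : ∫ ω, Var[V; P | MeasurableSpace.comap U inferInstance] ω ∂P = Var[Z; P] := by
    rw [condVar, integral_condExp hm, variance_of_integral_eq_zero hZm.aemeasurable hEZ]
    refine integral_congr_ae ?_
    filter_upwards [hce] with ω hω
    simp [hω, hZ]
  calc c = ∫ _, c ∂P := by simp
    _ ≤ _ := integral_mono_ae (integrable_const c) integrable_condVar hc
    _ = _ := hint

/-- Given `U = u`, the event on `V` says that the independent residual lies in an interval of
half-length `r` centred at `y - b * u`. The Gaussian bound does not see the centre, so the
regression coefficient drops out and the two bounds multiply. -/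
lemma measure_two_point_le {U V : Ω → ℝ} (hUm : Measurable U) (hVm : Measurable V)
    (h : HasGaussianLaw (fun ω => (U ω, V ω)) P) (hV : ∫ ω, V ω ∂P = 0) (hU : ∫ ω, U ω ∂P = 0)
    {a c : ℝ} (ha : 0 < a) (hvar : a ≤ Var[U; P]) (hc0 : 0 < c)
    (hc : ∀ᵐ ω ∂P, c ≤ Var[V; P | MeasurableSpace.comap U (inferInstance : MeasurableSpace ℝ)] ω)
    (x y : ℝ) {r : ℝ} (hr : 0 ≤ r) :
    P {ω | |U ω - x| ≤ r ∧ |V ω - y| ≤ r} ≤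
      ENNReal.ofReal (2 * r / √a) * ENNReal.ofReal (2 * r / √c) := by
  have : IsProbabilityMeasure P := h.isProbabilityMeasure
  obtain ⟨b, hind, hZ, hcZ⟩ := regression_of_hasGaussianLaw hUm hVm h hV hU
    (ha.trans_le hvar).ne' hc
  set Z : Ω → ℝ := fun ω => V ω - b * U ω with hZdef
  have hZm : Measurable Z := by fun_prop
  have key : ∀ (W : Ω → ℝ), HasGaussianLaw W P → ∀ d : ℝ, 0 < d → d ≤ Var[W; P] → ∀ z,
      P.map W {y | |y - z| ≤ r} ≤ ENNReal.ofReal (2 * r / √d) := by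
    intro W hW d hd hdW z
    rw [hW.map_eq_gaussianReal]
    refine (gaussianReal_interval_le _ (by simpa using hd.trans_le hdW) z r).trans ?_
    rw [Real.coe_toNNReal _ (variance_nonneg _ _)]
    gcongr
  have hSm : MeasurableSet {w : ℝ × ℝ | |w.1 - x| ≤ r ∧ |w.2 - (y - b * w.1)| ≤ r} := by
    apply MeasurableSet.inter
    · exact measurableSet_le (f := fun w : ℝ × ℝ => |w.1 - x|) (by fun_prop) measurable_const
    · exact measurableSet_le (f := fun w : ℝ × ℝ => |w.2 - (y - b * w.1)|) (by fun_prop)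
        measurable_const
  have h1 : {ω | |U ω - x| ≤ r ∧ |V ω - y| ≤ r} = (fun ω => (U ω, Z ω)) ⁻¹'
      {w : ℝ × ℝ | |w.1 - x| ≤ r ∧ |w.2 - (y - b * w.1)| ≤ r} := by
    ext ω
    simp only [Set.mem_ofPred_eq, Set.mem_preimage, hZdef]
    have : V ω - b * U ω - (y - b * U ω) = V ω - y := by ring
    rw [this]
  rw [h1, ← Measure.map_apply (by fun_prop) hSm,
    (indepFun_iff_map_prod_eq_prod_map_map hUm.aemeasurable hZm.aemeasurable).1 hind,
    Measure.prod_apply hSm]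
  have hAm : MeasurableSet {u : ℝ | |u - x| ≤ r} :=
    measurableSet_le (by fun_prop) measurable_const
  calc _ ≤ ∫⁻ u, {u : ℝ | |u - x| ≤ r}.indicator (fun _ => ENNReal.ofReal (2 * r / √c)) u
        ∂(P.map U) := by
        refine lintegral_mono fun u => ?_
        by_cases hu : |u - x| ≤ r
        · simp only [Set.indicator_of_mem (show u ∈ {u : ℝ | |u - x| ≤ r} from hu)]
          refine (measure_mono ?_).trans (key Z hZ c hc0 hcZ (y - b * u))
          intro z hz
          exact hz.2
        · have : Prod.mk u ⁻¹' {w : ℝ × ℝ | |w.1 - x| ≤ r ∧ |w.2 - (y - b * w.1)| ≤ r} = ∅ := by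
            ext z
            simp [hu]
          simp [this]
    _ = ENNReal.ofReal (2 * r / √c) * P.map U {u | |u - x| ≤ r} := by
        rw [lintegral_indicator hAm, setLIntegral_const]
    _ ≤ _ := by
        rw [mul_comm]
        gcongr
        exact key U h.fst a ha hvar x

end Regression

/-! ### Transfer of the Gaussian estimates to the vector-valued field -/

section Copies

variable {N p : ℕ} {Ω₀ Ω : Type*} [MeasurableSpace Ω₀] [MeasurableSpace Ω]
  {P₀ : Measure Ω₀} {P : Measure Ω} {X : EuclideanSpace ℝ (Fin N) → Ω₀ → ℝ}
  {Y : Fin p → EuclideanSpace ℝ (Fin N) → Ω → ℝ}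

lemma AreIndependentCopies.measure_path (hY : AreIndependentCopies Y P X P₀) (i : Fin p)
    {S : Set (EuclideanSpace ℝ (Fin N) → ℝ)} (hS : MeasurableSet S) :
    P {ω | (fun t => Y i t ω) ∈ S} = P₀ {ω | (fun t => X t ω) ∈ S} :=
  (hY.identDistrib i).measure_mem_eq hS

/-- Stated for events on whole paths, so that one-point and two-point events both factor over the
copies. -/
lemma AreIndependentCopies.measure_forall (hY : AreIndependentCopies Y P X P₀)
    (S : Fin p → Set (EuclideanSpace ℝ (Fin N) → ℝ)) (hS : ∀ i, MeasurableSet (S i)) :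
    P {ω | ∀ i, (fun t => Y i t ω) ∈ S i} = ∏ i, P₀ {ω | (fun t => X t ω) ∈ S i} := by
  have h := hY.indep.measure_inter_preimage_eq_mul Finset.univ (sets := S) (fun i _ => hS i)
  have h1 : (⋂ i ∈ Finset.univ, (fun ω t => Y i t ω) ⁻¹' S i) =
      {ω | ∀ i, (fun t => Y i t ω) ∈ S i} := by
    ext ω; simp
  rw [← h1, h]
  exact Finset.prod_congr rfl fun i _ => hY.measure_path i (hS i)

lemma measurableSet_path_near (t : EuclideanSpace ℝ (Fin N)) (x r : ℝ) :
    MeasurableSet {f : EuclideanSpace ℝ (Fin N) → ℝ | |f t - x| ≤ r} :=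
  measurableSet_le (f := fun f : EuclideanSpace ℝ (Fin N) → ℝ => |f t - x|)
    (by fun_prop) measurable_const

lemma IsCenteredGaussianField.measure_preimage (hX : IsCenteredGaussianField X P₀)
    (t : EuclideanSpace ℝ (Fin N)) {S : Set ℝ} (hS : MeasurableSet S) :
    P₀ {ω | X t ω ∈ S} = gaussianReal 0 Var[X t; P₀].toNNReal S := by
  have h := (hX.gaussian.hasGaussianLaw_eval t).map_eq_gaussianReal
  rw [hX.centered t] at h
  rw [← h, Measure.map_apply (hX.measurable t) hS]
  rfl

lemma measurableSet_near (x r : ℝ) : MeasurableSet {y : ℝ | |y - x| ≤ r} :=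
  measurableSet_le (f := fun y : ℝ => |y - x|) (by fun_prop) measurable_const

lemma measure_near_le (hX : IsCenteredGaussianField X P₀) (hY : AreIndependentCopies Y P X P₀)
    {a : ℝ} (ha : 0 < a) {t : EuclideanSpace ℝ (Fin N)} (hvar : a ≤ Var[X t; P₀])
    (x : Fin p → ℝ) {r : ℝ} (hr : 0 ≤ r) :
    P {ω | ∀ i, |Y i t ω - x i| ≤ r} ≤ ENNReal.ofReal (2 * r / √a) ^ p := by
  have h := hY.measure_forall (fun i => {f | |f t - x i| ≤ r})
    (fun i => measurableSet_path_near t (x i) r)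
  calc _ = _ := h
    _ ≤ ∏ _i : Fin p, ENNReal.ofReal (2 * r / √a) := by
        refine Finset.prod_le_prod' fun i _ => ?_
        refine (hX.measure_preimage t (measurableSet_near (x i) r)).trans_le ?_
        refine (gaussianReal_interval_le _ (by simpa using ha.trans_le hvar) _ r).trans ?_
        rw [Real.coe_toNNReal _ (variance_nonneg _ _)]
        gcongr
    _ = _ := by simp

lemma le_measure_near (hX : IsCenteredGaussianField X P₀) (hY : AreIndependentCopies Y P X P₀)
    {a b : ℝ} (ha : 0 < a) (hb : 0 < b) (x : Fin p → ℝ) :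
    ∃ C : ENNReal, C ≠ 0 ∧ ∀ t, a ≤ Var[X t; P₀] → Var[X t; P₀] ≤ b → ∀ r : ℝ, 0 ≤ r → r ≤ 1 →
      C * ENNReal.ofReal r ^ p ≤ P {ω | ∀ i, |Y i t ω - x i| ≤ r} := by
  refine ⟨∏ i, ENNReal.ofReal
    (2 * ((√(2 * Real.pi * b))⁻¹ * Real.exp (-(|x i| + 1) ^ 2 / (2 * a)))), ?_, ?_⟩
  · rw [Finset.prod_ne_zero_iff]
    intro i _
    have : 0 < 2 * ((√(2 * Real.pi * b))⁻¹ * Real.exp (-(|x i| + 1) ^ 2 / (2 * a))) := by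
      positivity
    exact (ENNReal.ofReal_pos.2 this).ne'
  · intro t hat htb r hr0 hr1
    have h := hY.measure_forall (fun i => {f | |f t - x i| ≤ r})
      (fun i => measurableSet_path_near t (x i) r)
    refine le_trans ?_ h.ge
    have hpow : ENNReal.ofReal r ^ p = ∏ _i : Fin p, ENNReal.ofReal r := by simp
    rw [hpow, ← Finset.prod_mul_distrib]
    refine Finset.prod_le_prod' fun i _ => ?_
    refine le_trans ?_ (hX.measure_preimage t (measurableSet_near (x i) r)).ge
    refine le_trans ?_ (le_gaussianReal_interval ha (b := b) ?_ ?_ (x i) hr1)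
    · rw [← ENNReal.ofReal_mul (by positivity)]
      apply le_of_eq
      congr 1
      ring
    · rwa [Real.coe_toNNReal _ (variance_nonneg _ _)]
    · rwa [Real.coe_toNNReal _ (variance_nonneg _ _)]

lemma measure_near_near_le (hX : IsCenteredGaussianField X P₀)
    (hY : AreIndependentCopies Y P X P₀) {a c : ℝ} (ha : 0 < a) (hc : 0 < c)
    {s t : EuclideanSpace ℝ (Fin N)} (hvar : a ≤ Var[X s; P₀])
    (hcond : ∀ᵐ ω ∂P₀, c ≤
      Var[X t; P₀ | MeasurableSpace.comap (X s) (inferInstance : MeasurableSpace ℝ)] ω)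
    (x : Fin p → ℝ) {r : ℝ} (hr : 0 ≤ r) :
    P {ω | (∀ i, |Y i s ω - x i| ≤ r) ∧ ∀ i, |Y i t ω - x i| ≤ r} ≤
      (ENNReal.ofReal (2 * r / √a) * ENNReal.ofReal (2 * r / √c)) ^ p := by
  have h := hY.measure_forall (fun i => {f | |f s - x i| ≤ r} ∩ {f | |f t - x i| ≤ r})
    (fun i => (measurableSet_path_near s (x i) r).inter (measurableSet_path_near t (x i) r))
  calc _ = P {ω | ∀ i, (fun t => Y i t ω) ∈
          ({f | |f s - x i| ≤ r} ∩ {f | |f t - x i| ≤ r} : Set (EuclideanSpace ℝ (Fin N) → ℝ))} := by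
        congr 1
        ext ω
        exact forall_and.symm
    _ = _ := h
    _ ≤ ∏ _i : Fin p, (ENNReal.ofReal (2 * r / √a) * ENNReal.ofReal (2 * r / √c)) := by
        refine Finset.prod_le_prod' fun i _ => ?_
        exact measure_two_point_le (hX.measurable s) (hX.measurable t)
          hX.gaussian.hasGaussianLaw_prodMk (hX.centered t) (hX.centered s) ha hvar hc hcond
          (x i) (x i) hr
    _ = _ := by simp

lemma measure_increment_le (hX : IsCenteredGaussianField X P₀)
    (hY : AreIndependentCopies Y P X P₀) (q : ℕ) :
    ∃ M : ENNReal, M ≠ ⊤ ∧ ∀ (s t : EuclideanSpace ℝ (Fin N)) (σ l : ℝ), 0 < l → 0 ≤ σ →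
      ∫ ω, (X t ω - X s ω) ^ 2 ∂P₀ ≤ σ ^ 2 →
      P {ω | ∃ i, l ≤ |Y i t ω - Y i s ω|} ≤ M * ENNReal.ofReal ((σ / l) ^ q) := by
  obtain ⟨M, hM, hbound⟩ := gaussianReal_tail_le q
  refine ⟨p * M, by finiteness, fun s t σ l hl hσ hvar => ?_⟩
  have hS : MeasurableSet {f : EuclideanSpace ℝ (Fin N) → ℝ | l ≤ |f t - f s|} :=
    measurableSet_le (g := fun f : EuclideanSpace ℝ (Fin N) → ℝ => |f t - f s|)
      measurable_const (by fun_prop)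
  have h0 : P₀ {ω | l ≤ |X t ω - X s ω|} ≤ M * ENNReal.ofReal ((σ / l) ^ q) := by
    have hg : HasGaussianLaw (fun ω => X t ω - X s ω) P₀ := hX.gaussian.hasGaussianLaw_fun_sub
    have hm : Measurable (fun ω => X t ω - X s ω) := (hX.measurable t).sub (hX.measurable s)
    have hE : ∫ ω, (X t ω - X s ω) ∂P₀ = 0 := by
      rw [integral_sub (hX.gaussian.hasGaussianLaw_eval t).integrable
        (hX.gaussian.hasGaussianLaw_eval s).integrable, hX.centered, hX.centered, sub_zero]
    have hmap := hg.map_eq_gaussianReal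
    rw [hE, variance_of_integral_eq_zero hm.aemeasurable hE] at hmap
    have hl' : MeasurableSet {y : ℝ | l ≤ |y|} := measurableSet_le measurable_const (by fun_prop)
    have h1 := Measure.map_apply (μ := P₀) hm hl'
    rw [hmap] at h1
    refine h1.symm.trans_le (hbound _ σ l hl ?_)
    rw [Real.coe_toNNReal _ (integral_nonneg fun _ => sq_nonneg _)]
    exact (Real.sqrt_le_left hσ).2 hvar
  calc P {ω | ∃ i, l ≤ |Y i t ω - Y i s ω|}
      = P (⋃ i, {ω | l ≤ |Y i t ω - Y i s ω|}) := by congr 1; ext ω; simp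
    _ ≤ ∑ i, P {ω | l ≤ |Y i t ω - Y i s ω|} := measure_iUnion_fintype_le _ _
    _ ≤ ∑ _i : Fin p, M * ENNReal.ofReal ((σ / l) ^ q) := by
        refine Finset.sum_le_sum fun i _ => ?_
        exact (hY.measure_path i hS).trans_le h0
    _ = _ := by simp [mul_assoc]

end Copies

/-! ### Bounds on the variance over the cube. -/

section Variance

variable {N : ℕ} {Ω₀ : Type*} [MeasurableSpace Ω₀] {P₀ : Measure Ω₀}
  {X : EuclideanSpace ℝ (Fin N) → Ω₀ → ℝ} {H : Fin N → ℝ}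

lemma cube_mono {a a' b : ℝ} (h : a ≤ a') : cube N a' b ⊆ cube N a b :=
  fun _ ht j => ⟨h.trans (ht j).1, (ht j).2⟩

lemma isCompact_cube (a b : ℝ) : IsCompact (cube N a b) := by
  have h : cube N a b = (EuclideanSpace.equiv (Fin N) ℝ).toHomeomorph ⁻¹'
      (Set.univ.pi fun _ => Set.Icc a b) := by
    ext t
    simp only [cube, Set.mem_ofPred_eq, Set.mem_preimage, Set.mem_univ_pi]
    rfl
  rw [h, Homeomorph.isCompact_preimage]
  exact isCompact_univ_pi fun _ => isCompact_Icc

lemma IsCenteredGaussianField.variance_eq (hX : IsCenteredGaussianField X P₀)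
    (t : EuclideanSpace ℝ (Fin N)) : Var[X t; P₀] = ∫ ω, X t ω ^ 2 ∂P₀ :=
  variance_of_integral_eq_zero (hX.measurable t).aemeasurable (hX.centered t)

lemma IsCenteredGaussianField.memLp (hX : IsCenteredGaussianField X P₀)
    (t : EuclideanSpace ℝ (Fin N)) : MemLp (X t) 2 P₀ :=
  (hX.gaussian.hasGaussianLaw_eval t).memLp_two

lemma anisoScale_le (hH : ∀ j, 0 < H j) {s t : EuclideanSpace ℝ (Fin N)}
    (hs : s ∈ cube N 0 1) (ht : t ∈ cube N 0 1) : anisoScale H s t ≤ N := by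
  calc anisoScale H s t ≤ ∑ _j : Fin N, (1 : ℝ) := by
        refine Finset.sum_le_sum fun j _ => ?_
        refine Real.rpow_le_one (abs_nonneg _) ?_ (by linarith [hH j])
        rw [abs_le]
        constructor <;> linarith [(hs j).1, (hs j).2, (ht j).1, (ht j).2]
    _ = N := by simp

/-- Under (D1) the variance is bounded on the unit cube. -/
lemma exists_variance_le (hH : ∀ j, 0 < H j) (hX : IsCenteredGaussianField X P₀)
    (hD1 : ConditionD1 H X P₀) :
    ∃ b : ℝ, 0 < b ∧ ∀ t ∈ cube N 0 1, Var[X t; P₀] ≤ b := by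
  obtain ⟨δ, c, hδ, hc, h⟩ := hD1
  obtain ⟨F, hF, hFfin, hcov⟩ := (isCompact_cube (N := N) 0 1).finite_cover_balls hδ
  refine ⟨1 + 2 * (c * N) + 2 * ∑ s ∈ hFfin.toFinset, Var[X s; P₀], ?_, ?_⟩
  · have := Finset.sum_nonneg (s := hFfin.toFinset)
      (fun s _ => variance_nonneg (X s) P₀)
    positivity
  · intro t ht
    have h1 := hcov ht
    simp only [Set.mem_iUnion, Metric.mem_ball, exists_prop] at h1
    obtain ⟨s, hs, hst⟩ := h1
    rw [dist_comm, dist_eq_norm] at hst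
    have h2 := (h s (hF hs) t ht hst.le).2
    have h3 := anisoScale_le hH (hF hs) ht
    have h4 : Var[X s; P₀] ≤ ∑ s ∈ hFfin.toFinset, Var[X s; P₀] :=
      Finset.single_le_sum (f := fun s => Var[X s; P₀]) (fun s _ => variance_nonneg _ _)
        (by simpa using hs)
    have h5 : ∫ ω, X t ω ^ 2 ∂P₀ ≤
        ∫ ω, (2 * (X t ω - X s ω) ^ 2 + 2 * X s ω ^ 2) ∂P₀ := by
      refine integral_mono (hX.memLp t).integrable_sq
        (((((hX.memLp t).sub (hX.memLp s)).integrable_sq).const_mul 2).add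
          (((hX.memLp s).integrable_sq).const_mul 2)) fun ω => ?_
      simp only
      nlinarith [sq_nonneg (X t ω - 2 * X s ω)]
    have hsub : Integrable (fun ω => (X t ω - X s ω) ^ 2) P₀ :=
      ((hX.memLp t).sub (hX.memLp s)).integrable_sq
    have h6 : ∫ ω, (2 * (X t ω - X s ω) ^ 2 + 2 * X s ω ^ 2) ∂P₀ =
        2 * ∫ ω, (X t ω - X s ω) ^ 2 ∂P₀ + 2 * Var[X s; P₀] := by
      rw [integral_add (hsub.const_mul 2)
        (((hX.memLp s).integrable_sq).const_mul 2), integral_const_mul, integral_const_mul,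
        hX.variance_eq s]
    rw [hX.variance_eq t]
    have h7 : c * anisoScale H s t ≤ c * N := by gcongr
    linarith

/-- Under (D2) the variance is bounded away from zero on `[1/2, 1]^N`. -/
lemma exists_le_variance [NeZero N] (hX : IsCenteredGaussianField X P₀)
    (hH : ∀ j, 0 < H j) (hD2 : ConditionD2 H X P₀) :
    ∃ a : ℝ, 0 < a ∧ ∀ t ∈ cube N (1 / 2) 1, a ≤ Var[X t; P₀] := by
  have : IsProbabilityMeasure P₀ := hX.gaussian.isProbabilityMeasure
  obtain ⟨c, hc, h⟩ := hD2 (1 / 2) (by norm_num)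
  let j₀ : Fin N := 0
  refine ⟨c * ((1 / 4 : ℝ) ^ (2 * H j₀)), by positivity, fun u hu => ?_⟩
  -- One of the two corners `(1, …, 1)` and `(1/2, …, 1/2)` is at distance at least `1/4` from `u`
  -- in the direction `j₀`; conditioning on the field there bounds `Var[X u]` from below through the
  -- law of total variance.
  obtain ⟨t, ht, htu⟩ : ∃ t ∈ cube N (1 / 2) 1, (1 / 4 : ℝ) ≤ |u j₀ - t j₀| := by
    rcases le_total (u j₀) (3 / 4) with h1 | h1
    · refine ⟨WithLp.toLp 2 fun _ => 1, fun j => by norm_num, ?_⟩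
      rw [abs_sub_comm]
      exact le_trans (by simp only; linarith) (le_abs_self _)
    · refine ⟨WithLp.toLp 2 fun _ => 1 / 2, fun j => by norm_num, ?_⟩
      exact le_trans (by simp only; linarith) (le_abs_self _)
  have hH0 := (hH j₀).le
  have h2 : (1 / 4 : ℝ) ^ (2 * H j₀) ≤ anisoScale H u t := by
    refine le_trans ?_ (Finset.single_le_sum (f := fun j => |u j - t j| ^ (2 * H j))
      (fun j _ => by positivity) (Finset.mem_univ j₀))
    exact Real.rpow_le_rpow (by norm_num) htu (by linarith)
  have hm := (hX.measurable t).comap_le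
  have h3 := integral_condVar_add_variance_condExp hm (hX.memLp u)
  have h4 : c * anisoScale H u t ≤ ∫ ω, Var[X u; P₀ |
      MeasurableSpace.comap (X t) (inferInstance : MeasurableSpace ℝ)] ω ∂P₀ := by
    calc _ = ∫ _, c * anisoScale H u t ∂P₀ := by simp
      _ ≤ _ := integral_mono_ae (integrable_const _) integrable_condVar (h u hu t ht)
  have h5 := variance_nonneg (P₀[X u | MeasurableSpace.comap (X t) inferInstance]) P₀
  calc _ ≤ c * anisoScale H u t := by gcongr
    _ ≤ _ := by linarith

end Variance

/-! ### An energy criterion for Hausdorff measure -/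

section Energy

open Filter

variable {E : Type*} [MetricSpace E] [MeasurableSpace E] [BorelSpace E]

/-- A set of zero Hausdorff measure has open covers with arbitrarily small sums of powers of
diameters. -/
lemma exists_open_cover_of_hausdorffMeasure_eq_zero {g : ℝ} (hg : 0 < g) {K : Set E}
    (hK : μH[g] K = 0) {ε : ENNReal} (hε : ε ≠ 0) :
    ∃ (U : ℕ → Set E) (ρ : ℕ → ENNReal), (∀ i, IsOpen (U i)) ∧ K ⊆ ⋃ i, U i ∧
      (∀ i, ∀ s ∈ U i, ∀ t ∈ U i, edist s t ≤ ρ i) ∧ (∀ i, ρ i ≠ 0) ∧ ∑' i, ρ i ^ g < ε := by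
  set ε' : ENNReal := ε / 2 ^ g / 2 with hε'
  have h2g : (2 : ENNReal) ^ g ≠ ⊤ := by finiteness
  have h2g0 : (2 : ENNReal) ^ g ≠ 0 := by simp
  have hε'0 : ε' ≠ 0 := by simp [hε', hε, h2g]
  have h1 : (⨅ (t : ℕ → Set E) (_ : K ⊆ ⋃ n, t n) (_ : ∀ n, Metric.ediam (t n) ≤ 1),
      ∑' n, ⨆ _ : (t n).Nonempty, Metric.ediam (t n) ^ g) < ε' := by
    rw [Measure.hausdorffMeasure_apply] at hK
    have := ENNReal.iSup_eq_zero.1 (ENNReal.iSup_eq_zero.1 hK 1) one_pos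
    rw [this]
    exact pos_iff_ne_zero.2 hε'0
  simp only [iInf_lt_iff] at h1
  obtain ⟨t, hKt, -, hsum⟩ := h1
  obtain ⟨e, he, hesum⟩ := ENNReal.exists_pos_sum_of_countable' hε'0 ℕ
  -- The summable `e i` make the radius strictly larger than the diameter, even for a single point,
  -- so an open ball of radius `r i` about a point of `t i` contains `t i`. The bound `2 * r i` on
  -- distances within this ball accounts for the `2 ^ g` in `ε'`.
  set r : ℕ → ENNReal := fun i => (Metric.ediam (t i) ^ g + e i) ^ g⁻¹ with hr
  have hrg : ∀ i, r i ^ g = Metric.ediam (t i) ^ g + e i := fun i => by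
    rw [hr]; simp only; rw [← ENNReal.rpow_mul, inv_mul_cancel₀ hg.ne', ENNReal.rpow_one]
  have hsum' : ∑' i, r i ^ g < ε / 2 ^ g := by
    calc ∑' i, r i ^ g = ∑' i, Metric.ediam (t i) ^ g + ∑' i, e i := by
          simp_rw [hrg]; exact ENNReal.tsum_add
      _ < ε' + ε' := by
          refine ENNReal.add_lt_add (lt_of_le_of_lt (ENNReal.tsum_le_tsum fun i => ?_) hsum) hesum
          rcases (t i).eq_empty_or_nonempty with h | h
          · simp [h, hg]
          · simp [h]
      _ = _ := ENNReal.add_halves _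
  have hrfin : ∀ i, r i ≠ ⊤ := by
    intro i hi
    have : r i ^ g ≠ ⊤ := ((ENNReal.le_tsum i).trans_lt (hsum'.trans_le le_top)).ne
    exact this (by rw [hi]; exact ENNReal.top_rpow_of_pos hg)
  have hlt : ∀ i, Metric.ediam (t i) < r i := by
    intro i
    rw [← ENNReal.rpow_lt_rpow_iff hg, hrg i]
    refine ENNReal.lt_add_right ?_ (he i).ne'
    have := hrg i ▸ (ENNReal.rpow_ne_top_of_nonneg hg.le (hrfin i))
    exact (ENNReal.add_ne_top.1 this).1
  refine ⟨fun i => ⋃ h : (t i).Nonempty, Metric.eball h.some (r i),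
    fun i => 2 * r i, ?_, ?_, ?_, ?_, ?_⟩
  · intro i
    exact isOpen_iUnion fun _ => Metric.isOpen_eball
  · intro y hy
    obtain ⟨i, hi⟩ := Set.mem_iUnion.1 (hKt hy)
    have hne : (t i).Nonempty := ⟨y, hi⟩
    simp only [Set.mem_iUnion]
    refine ⟨i, hne, ?_⟩
    exact (Metric.edist_le_ediam_of_mem hi hne.some_mem).trans_lt (hlt i)
  · intro i s hs u hu
    simp only [Set.mem_iUnion] at hs hu
    obtain ⟨h, hsx⟩ := hs
    obtain ⟨_, huy⟩ := hu
    calc edist s u ≤ edist s h.some + edist h.some u := edist_triangle _ _ _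
      _ ≤ r i + r i := add_le_add hsx.le (by rw [edist_comm]; exact huy.le)
      _ = 2 * r i := (two_mul _).symm
  · intro i
    have := (zero_le (a := Metric.ediam (t i))).trans_lt (hlt i)
    simp [this.ne']
  · simp_rw [ENNReal.mul_rpow_of_nonneg _ _ hg.le]
    rw [ENNReal.tsum_mul_left, mul_comm]
    exact (ENNReal.lt_div_iff_mul_lt (Or.inl h2g0) (Or.inl h2g)).1 hsum'

/-- If `m ≥ l * D`, then `m * l ≤ D⁻¹ * m * m ≤ I`. Being additive in `D` and `I`, the conclusion
can be summed over a cover, in place of Cauchy–Schwarz. -/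
lemma ENNReal.le_mul_add_div_of_sq_le {m D I l : ENNReal} (hD : D ≠ 0) (hDt : D ≠ ⊤) (hl : l ≠ 0)
    (hlt : l ≠ ⊤) (h : D⁻¹ * m * m ≤ I) : m ≤ l * D + I / l := by
  rcases le_total m (l * D) with h1 | h1
  · exact h1.trans le_self_add
  · refine le_add_left ?_
    rw [ENNReal.le_div_iff_mul_le (Or.inl hl) (Or.inl hlt)]
    refine le_trans ?_ h
    calc m * l = D⁻¹ * (l * D) * m := by
          rw [mul_comm l D, ← mul_assoc, ENNReal.inv_mul_cancel hD hDt, one_mul, mul_comm]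
      _ ≤ D⁻¹ * m * m := by gcongr

/-- If finite measures concentrating on `K` frequently have mass bounded below and `g`-energy
bounded above, then `K` has positive `g`-dimensional Hausdorff measure. -/
theorem hausdorffMeasure_ne_zero_of_energy_le {g : ℝ} (hg : 0 < g) (μ : ℕ → Measure E)
    {K : Set E}
    (hK : ∀ U, IsOpen U → K ⊆ U → ∀ᶠ n in atTop, μ n Uᶜ = 0) {a M : ℝ} (ha : 0 < a) (hM : 0 < M)
    (hfreq : ∃ᶠ n in atTop, ENNReal.ofReal a ≤ μ n Set.univ ∧
      ∫⁻ s, ∫⁻ t, edist s t ^ (-g) ∂μ n ∂μ n ≤ ENNReal.ofReal M) : μH[g] K ≠ 0 := by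
  intro h0
  -- With this `l`, the energy contributes `M / l = a / 4` and the cover contributes less than `l *
  -- (a / (4 * l)) = a / 4`, so the total mass is at most `a / 2`.
  set l : ℝ := 4 * M / a with hl
  have hl0 : 0 < l := by positivity
  obtain ⟨U, ρ, hU, hKU, hρ, hρ0, hsum⟩ := exists_open_cover_of_hausdorffMeasure_eq_zero hg h0
    (ε := ENNReal.ofReal (a / (4 * l))) (by simp; positivity)
  obtain ⟨n, ⟨hna, hnM⟩, hnU⟩ :=
    (hfreq.and_eventually (hK _ (isOpen_iUnion hU) hKU)).exists
  have hVm : ∀ i, MeasurableSet (disjointed U i) :=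
    fun i => MeasurableSet.disjointed (fun i => (hU i).measurableSet) i
  have hVU : ⋃ i, disjointed U i = ⋃ i, U i := iUnion_disjointed
  have hρfin : ∀ i, ρ i ≠ ⊤ := by
    intro i hi
    have : ρ i ^ g ≠ ⊤ := ((ENNReal.le_tsum i).trans_lt (hsum.trans_le le_top)).ne
    exact this (by rw [hi]; exact ENNReal.top_rpow_of_pos hg)
  set I : ℕ → ENNReal := fun i => ∫⁻ s in disjointed U i, ∫⁻ t, edist s t ^ (-g) ∂μ n ∂μ n with hI
  have hIsum : ∑' i, I i ≤ ENNReal.ofReal M := by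
    rw [hI, ← lintegral_iUnion hVm (disjoint_disjointed U)]
    exact (setLIntegral_le_lintegral _ _).trans hnM
  -- On a piece where distances are at most `ρ i` the kernel is at least `ρ i ^ (-g)`, so the
  -- squared mass of the piece times `ρ i ^ (-g)` is at most its share of the energy.
  have hmI : ∀ i, μ n (disjointed U i) ≤
      ENNReal.ofReal l * ρ i ^ g + I i / ENNReal.ofReal l := by
    intro i
    refine ENNReal.le_mul_add_div_of_sq_le (by simp [hρ0 i, hρfin i])
      (ENNReal.rpow_ne_top_of_nonneg hg.le (hρfin i)) (by simpa using hl0) (by simp) ?_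
    calc (ρ i ^ g)⁻¹ * μ n (disjointed U i) * μ n (disjointed U i)
        = ∫⁻ _ in disjointed U i, ∫⁻ _ in disjointed U i, (ρ i ^ g)⁻¹ ∂μ n ∂μ n := by
          simp
      _ ≤ ∫⁻ s in disjointed U i, ∫⁻ t in disjointed U i, edist s t ^ (-g) ∂μ n ∂μ n := by
          refine setLIntegral_mono' (hVm i) fun s hs => setLIntegral_mono' (hVm i) fun t ht => ?_
          rw [ENNReal.rpow_neg]
          gcongr
          exact hρ i s (disjointed_subset U i hs) t (disjointed_subset U i ht)
      _ ≤ _ := lintegral_mono fun s => setLIntegral_le_lintegral _ _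
  have htot : μ n Set.univ ≤ ENNReal.ofReal (a / 2) := by
    calc μ n Set.univ ≤ μ n (⋃ i, U i) + μ n (⋃ i, U i)ᶜ := by
          rw [← Set.union_compl_self (⋃ i, U i)]; exact measure_union_le _ _
      _ = μ n (⋃ i, disjointed U i) := by rw [hnU, add_zero, hVU]
      _ ≤ ∑' i, μ n (disjointed U i) := measure_iUnion_le _
      _ ≤ ∑' i, (ENNReal.ofReal l * ρ i ^ g + I i / ENNReal.ofReal l) :=
          ENNReal.tsum_le_tsum hmI
      _ = ENNReal.ofReal l * ∑' i, ρ i ^ g + (∑' i, I i) / ENNReal.ofReal l := by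
          rw [ENNReal.tsum_add, ENNReal.tsum_mul_left]
          simp_rw [div_eq_mul_inv]
          rw [ENNReal.tsum_mul_right]
      _ ≤ ENNReal.ofReal l * ENNReal.ofReal (a / (4 * l)) +
          ENNReal.ofReal M / ENNReal.ofReal l := by gcongr
      _ = ENNReal.ofReal (a / 2) := by
          rw [← ENNReal.ofReal_mul hl0.le, ← ENNReal.ofReal_div_of_pos hl0,
            ← ENNReal.ofReal_add (by positivity) (by positivity)]
          congr 1
          rw [hl]
          field_simp
          ring
  have := (ENNReal.ofReal_le_ofReal_iff (by positivity)).1 (hna.trans htot)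
  linarith

end Energy

/-! ### Singular kernels on the cube and the optimal choice of exponents -/

section Kernel

/-- Exponents realizing integrability of a product majorant: the optimum of the associated
linear program is one of the expressions whose minimum is `levelDim`. -/
lemma exists_exponents {N : ℕ} [NeZero N] {H : Fin N → ℝ} (hH : ∀ j, 0 < H j) {p : ℕ}
    (hp : (p : ℝ) < ∑ j, 1 / H j) {g : ℝ} (hg0 : 0 ≤ g) (hg : g < levelDim H p) :
    ∃ a b : Fin N → ℝ, (∀ j, 0 ≤ a j) ∧ (∀ j, 0 ≤ b j) ∧ ∑ j, a j = g ∧ ∑ j, b j = p ∧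
      ∀ j, a j + H j * b j < 1 := by
  classical
  set Q := ∑ j, 1 / H j with hQ
  have hp0 : (0 : ℝ) ≤ p := Nat.cast_nonneg p
  have hQ0 : 0 < Q := hp0.trans_lt hp
  -- the greedy index
  obtain ⟨k, hk1, hk2⟩ : ∃ k : Fin N, (p : ℝ) ≤ ∑ j ∈ Finset.Iic k, 1 / H j ∧
      ∑ j ∈ Finset.Iio k, 1 / H j ≤ p := by
    set F := Finset.univ.filter fun k : Fin N => (p : ℝ) ≤ ∑ j ∈ Finset.Iic k, 1 / H j with hF
    have hne : F.Nonempty := by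
      refine ⟨⊤, ?_⟩
      simpa [hF, hQ] using hp.le
    refine ⟨F.min' hne, by simpa [hF] using F.min'_mem hne, ?_⟩
    rcases (Finset.Iio (F.min' hne)).eq_empty_or_nonempty with h | h
    · rw [h]; simp
    · have hm := Finset.max'_mem _ h
      set m := (Finset.Iio (F.min' hne)).max' h
      have hmF : m ∉ F := fun hmF => absurd (F.min'_le m hmF) (not_le.2 (Finset.mem_Iio.1 hm))
      have h1 : ∑ j ∈ Finset.Iic m, 1 / H j < p := by simpa [hF] using hmF
      refine le_trans (Finset.sum_le_sum_of_subset_of_nonneg ?_ fun j _ _ => ?_) h1.le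
      · intro j hj
        exact Finset.mem_Iic.2 (Finset.le_max' _ j hj)
      · exact (one_div_pos.2 (hH j)).le
  have hIic : ∑ j ∈ Finset.Iic k, 1 / H j = ∑ j ∈ Finset.Iio k, 1 / H j + 1 / H k := by
    rw [← Finset.Iio_insert, Finset.sum_insert (by simp), add_comm]
  set R := (p : ℝ) - ∑ j ∈ Finset.Iio k, 1 / H j with hR
  have hR0 : 0 ≤ R := by linarith
  have hR1 : H k * R ≤ 1 := by
    have : R ≤ 1 / H k := by linarith
    calc H k * R ≤ H k * (1 / H k) := mul_le_mul_of_nonneg_left this (hH k).le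
      _ = 1 := mul_one_div_cancel (hH k).ne'
  -- The total `p` is spent greedily: the indices before `k` are saturated (`H j * b₁ j = 1`) and
  -- `k` takes the remainder `R`. The slack `N - ∑ H j * b₁ j` is then exactly the `k`-th expression
  -- in `levelDim`.
  set b₁ : Fin N → ℝ := fun j => (if j < k then 1 / H j else 0) + (if j = k then R else 0)
  have hb₁0 : ∀ j, 0 ≤ b₁ j := fun j => by
    have := (one_div_pos.2 (hH j)).le
    simp only [b₁]
    split_ifs <;> linarith
  have hb₁1 : ∀ j, H j * b₁ j ≤ 1 := fun j => by
    simp only [b₁]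
    rcases lt_trichotomy j k with h | h | h
    · simp [h, h.ne, mul_inv_cancel₀ (hH j).ne']
    · subst h; simpa using hR1
    · simp [h.not_gt, h.ne']
  have hfil : Finset.univ.filter (fun j => j < k) = Finset.Iio k := by ext; simp
  have hb₁s : ∑ j, b₁ j = p := by
    simp only [b₁]
    rw [Finset.sum_add_distrib, ← Finset.sum_filter, hfil, Finset.sum_ite_eq' Finset.univ k]
    simp [hR]
  have hb₁c : ∑ j, H j * b₁ j = (k : ℕ) + H k * R := by
    have : ∀ j, H j * b₁ j = (if j < k then 1 else 0) + (if j = k then H k * R else 0) := by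
      intro j
      simp only [b₁]
      split_ifs with h1 h2 h2
      · exact absurd h2 h1.ne
      · simp [mul_inv_cancel₀ (hH j).ne']
      · subst h2; simp
      · simp
    simp_rw [this]
    rw [Finset.sum_add_distrib, ← Finset.sum_filter, hfil, Finset.sum_ite_eq' Finset.univ k]
    simp
  have hval : g < N - ∑ j, H j * b₁ j := by
    have h1 : levelDim H p ≤ (∑ j ∈ Finset.Iic k, H k / H j) + ((N : ℝ) - ((k : ℕ) + 1 : ℝ))
        - H k * (p : ℝ) := Finset.inf'_le _ (Finset.mem_univ k)
    have h2 : ∑ j ∈ Finset.Iic k, H k / H j = H k * ∑ j ∈ Finset.Iic k, 1 / H j := by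
      rw [Finset.mul_sum]
      exact Finset.sum_congr rfl fun j _ => by ring
    rw [h2, hIic, mul_add, mul_one_div_cancel (hH k).ne'] at h1
    rw [hb₁c, hR]
    linarith
  -- A strictly feasible point: every `H j * b₀ j` equals `p / Q < 1`. Mixing in a little of it
  -- makes the saturated constraints strict.
  set b₀ : Fin N → ℝ := fun j => (p : ℝ) / Q * (1 / H j) with hb₀
  have hpQ : (p : ℝ) / Q < 1 := (div_lt_one hQ0).2 hp
  have hpQ0 : 0 ≤ (p : ℝ) / Q := by positivity
  have hb₀H : ∀ j, H j * b₀ j = p / Q := fun j => by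
    simp only [hb₀]
    have := (hH j).ne'
    field_simp
  -- a small convex combination
  obtain ⟨e, he0, he1, heg⟩ : ∃ e : ℝ, 0 < e ∧ e ≤ 1 ∧
      g < (1 - e) * (N - ∑ j, H j * b₁ j) + e * (N - ∑ _j : Fin N, (p : ℝ) / Q) := by
    set D := (N - ∑ j, H j * b₁ j) with hD
    set D' := (N - ∑ _j : Fin N, (p : ℝ) / Q) with hD'
    have hD'0 : 0 ≤ D' := by
      simp only [hD', Finset.sum_const, Finset.card_univ, Fintype.card_fin, nsmul_eq_mul]
      nlinarith [(Nat.cast_nonneg N : (0 : ℝ) ≤ N)]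
    have hDpos : 0 < D := hg0.trans_lt hval
    refine ⟨(D - g) / (2 * D), by apply div_pos <;> linarith, ?_, ?_⟩
    · rw [div_le_one (by linarith)]; linarith
    · have h1 : (1 - (D - g) / (2 * D)) * D = (D + g) / 2 := by field_simp; ring
      have h2 : 0 ≤ (D - g) / (2 * D) * D' :=
        mul_nonneg (div_nonneg (by linarith) (by linarith)) hD'0
      rw [h1]
      linarith
  set b : Fin N → ℝ := fun j => (1 - e) * b₁ j + e * b₀ j with hb
  have hbH : ∀ j, H j * b j = (1 - e) * (H j * b₁ j) + e * (p / Q) := fun j => by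
    rw [← hb₀H j]; simp only [hb]; ring
  have hb1 : ∀ j, H j * b j < 1 := fun j => by
    rw [hbH]
    nlinarith [hb₁1 j]
  have hb0 : ∀ j, 0 ≤ b j := fun j => by
    have h1 := hb₁0 j
    have h2 : 0 ≤ b₀ j := mul_nonneg hpQ0 (one_div_pos.2 (hH j)).le
    simp only [hb]
    have : 0 ≤ 1 - e := by linarith
    positivity
  have hS : g < ∑ j, (1 - H j * b j) := by
    have : ∑ j, (1 - H j * b j) =
        (1 - e) * (N - ∑ j, H j * b₁ j) + e * (N - ∑ _j : Fin N, (p : ℝ) / Q) := by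
      simp_rw [hbH]
      rw [Finset.sum_sub_distrib, Finset.sum_add_distrib, ← Finset.mul_sum, ← Finset.mul_sum]
      simp
      ring
    rwa [this]
  set T := ∑ j, (1 - H j * b j) with hT
  have hT0 : 0 < T := hg0.trans_lt hS
  -- The exponents `a j` take the same fraction `g / T < 1` of the slack in each coordinate.
  refine ⟨fun j => g / T * (1 - H j * b j), b, fun j => ?_, hb0, ?_, ?_, fun j => ?_⟩
  · exact mul_nonneg (by positivity) (by linarith [hb1 j])
  · rw [← Finset.mul_sum, ← hT]; field_simp
  · simp only [hb]
    rw [Finset.sum_add_distrib, ← Finset.mul_sum, ← Finset.mul_sum, hb₁s]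
    simp only [hb₀]
    rw [← Finset.mul_sum, ← hQ]
    field_simp
    ring
  · have h1 : g / T < 1 := (div_lt_one hT0).2 hS
    nlinarith [hb1 j]

lemma exists_lintegral_abs_sub_rpow_le {θ : ℝ} (hθ : θ < 1) :
    ∃ C : ENNReal, C ≠ ⊤ ∧ ∀ y ∈ Set.Icc (0 : ℝ) 1,
      ∫⁻ x in Set.Icc (0 : ℝ) 1, ENNReal.ofReal |y - x| ^ (-θ) ≤ C := by
  refine ⟨∫⁻ z in Set.Icc (-1 : ℝ) 1, ENNReal.ofReal |z| ^ (-θ), ?_, fun y hy => ?_⟩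
  · have h1 : ∫⁻ z in Set.Icc (0 : ℝ) 1, ENNReal.ofReal |z| ^ (-θ) ≠ ⊤ := by
      have hint : IntegrableOn (fun x : ℝ => x ^ (-θ)) (Set.Ioc 0 1) := by
        rw [← intervalIntegrable_iff_integrableOn_Ioc_of_le zero_le_one]
        exact intervalIntegral.intervalIntegrable_rpow' (by linarith)
      rw [restrict_Ioc_eq_restrict_Icc.symm]
      have := hint.2.ne
      refine ne_of_eq_of_ne (setLIntegral_congr_fun measurableSet_Ioc fun x hx => ?_) this
      have hx0 : 0 < x := hx.1
      simp only
      rw [abs_of_pos hx0, ENNReal.ofReal_rpow_of_pos hx0,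
        Real.enorm_of_nonneg (Real.rpow_nonneg hx0.le _)]
    have h2 : ∫⁻ z in Set.Icc (-1 : ℝ) 0, ENNReal.ofReal |z| ^ (-θ) ≠ ⊤ := by
      have := (Measure.measurePreserving_neg (volume : Measure ℝ)).setLIntegral_comp_preimage_emb
        (MeasurableEquiv.neg ℝ).measurableEmbedding (fun z => ENNReal.ofReal |z| ^ (-θ))
        (Set.Icc (-1 : ℝ) 0)
      rw [← this]
      simpa using h1
    have h3 : Set.Icc (-1 : ℝ) 1 = Set.Icc (-1 : ℝ) 0 ∪ Set.Icc 0 1 :=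
      (Set.Icc_union_Icc_eq_Icc (by norm_num) (by norm_num)).symm
    rw [h3]
    exact ((lintegral_union_le _ _ _).trans_lt (ENNReal.add_lt_top.2 ⟨h2.lt_top, h1.lt_top⟩)).ne
  · have := (Measure.measurePreserving_sub_left (volume : Measure ℝ) y).setLIntegral_comp_preimage_emb
      (MeasurableEquiv.subLeft y).measurableEmbedding (fun z => ENNReal.ofReal |z| ^ (-θ))
      (Set.Icc (-1 : ℝ) 1)
    rw [← this]
    refine lintegral_mono_set fun x hx => ?_
    simp only [Set.mem_preimage, Set.mem_Icc] at *
    constructor <;> linarith [hx.1, hx.2, hy.1, hy.2]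

lemma setLIntegral_cube_prod {N : ℕ} (f : Fin N → ℝ → ENNReal) (hf : ∀ j, Measurable (f j)) :
    ∫⁻ t in cube N 0 1, ∏ j, f j (t j) = ∏ j, ∫⁻ x in Set.Icc (0 : ℝ) 1, f j x := by
  have hpre : cube N 0 1 = (WithLp.ofLp : EuclideanSpace ℝ (Fin N) → Fin N → ℝ) ⁻¹'
      (Set.univ.pi fun _ => Set.Icc 0 1) := by
    ext t
    simp only [cube, Set.mem_ofPred_eq, Set.mem_preimage, Set.mem_univ_pi]
  have h1 := (PiLp.volume_preserving_ofLp (Fin N)).setLIntegral_comp_preimage_emb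
    (MeasurableEquiv.toLp 2 (Fin N → ℝ)).symm.measurableEmbedding
    (fun x => ∏ j, f j (x j)) (Set.univ.pi fun _ => Set.Icc (0 : ℝ) 1)
  rw [hpre]
  refine h1.trans ?_
  rw [volume_pi, Measure.restrict_pi_pi]
  -- Since `[0, 1]` has mass one, Tonelli for the product integrand is the independence of the
  -- coordinates under a product probability measure.
  have hprob : IsProbabilityMeasure ((volume : Measure ℝ).restrict (Set.Icc (0 : ℝ) 1)) :=
    ⟨by simp⟩
  have hind := iIndepFun_pi (μ := fun _j : Fin N => volume.restrict (Set.Icc (0 : ℝ) 1))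
    (X := fun j x => f j x) (fun j => (hf j).aemeasurable)
  have h2 := lintegral_prod_eq_prod_lintegral_of_indepFun Finset.univ
    (fun j (x : Fin N → ℝ) => f j (x j)) hind (fun j => (hf j).comp (measurable_pi_apply j))
  rw [h2]
  refine Finset.prod_congr rfl fun j _ => ?_
  exact (measurePreserving_eval (fun _j : Fin N => volume.restrict (Set.Icc (0 : ℝ) 1))
    j).lintegral_comp (hf j)

lemma exists_lintegral_prod_kernel_le {N : ℕ} {θ : Fin N → ℝ} (hθ : ∀ j, θ j < 1) :
    ∃ C : ENNReal, C ≠ ⊤ ∧ ∀ s ∈ cube N 0 1,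
      ∫⁻ t in cube N 0 1, ∏ j, ENNReal.ofReal |s j - t j| ^ (-θ j) ≤ C := by
  choose C hC hCle using fun j => exists_lintegral_abs_sub_rpow_le (hθ j)
  refine ⟨∏ j, C j, ENNReal.prod_ne_top fun j _ => hC j, fun s hs => ?_⟩
  rw [setLIntegral_cube_prod (fun j x => ENNReal.ofReal |s j - x| ^ (-θ j)) (by fun_prop)]
  exact Finset.prod_le_prod' fun j _ => hCle j (s j) (hs j)

/-- This shares one singularity among the coordinates: split the power of `A` into factors and
shrink the base of each from `A` to `B j`, which can only increase a negative power. -/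
lemma ENNReal.rpow_neg_sum_le_prod {ι : Type*} [Fintype ι] {A : ENNReal} (hA : A ≠ 0)
    (hA' : A ≠ ⊤) {B : ι → ENNReal} (hB : ∀ j, B j ≤ A) {e : ι → ℝ} (he : ∀ j, 0 ≤ e j) :
    A ^ (-∑ j, e j) ≤ ∏ j, B j ^ (-e j) := by
  have hsum : A ^ (-∑ j, e j) = ∏ j, A ^ (-e j) := by
    classical
    rw [← Finset.sum_neg_distrib]
    induction (Finset.univ : Finset ι) using Finset.induction_on with
    | empty => simp
    | insert j S hj ih =>
      rw [Finset.sum_insert hj, Finset.prod_insert hj, ENNReal.rpow_add _ _ hA hA', ih]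
  rw [hsum]
  refine Finset.prod_le_prod' fun j _ => ?_
  rw [ENNReal.rpow_neg, ENNReal.rpow_neg]
  exact ENNReal.inv_le_inv.2 (ENNReal.rpow_le_rpow (hB j) (he j))

lemma ENNReal.rpow_neg_mul_rpow_neg {D : ENNReal} (hD : D ≠ ⊤) {a b : ℝ} (ha : 0 ≤ a)
    (hb : 0 ≤ b) : D ^ (-a) * D ^ (-b) = D ^ (-(a + b)) := by
  rw [ENNReal.rpow_neg, ENNReal.rpow_neg, ENNReal.rpow_neg, ENNReal.rpow_add_of_nonneg a b ha hb,
    ENNReal.mul_inv (Or.inr (by finiteness)) (Or.inl (by finiteness))]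

lemma anisoScale_pos {N : ℕ} {H : Fin N → ℝ} {s t : EuclideanSpace ℝ (Fin N)} (hst : s ≠ t) :
    0 < anisoScale H s t := by
  obtain ⟨j, hj⟩ : ∃ j, s j ≠ t j := by
    by_contra! h
    exact hst (PiLp.ext h)
  refine Finset.sum_pos' (fun j _ => by positivity) ⟨j, Finset.mem_univ j, ?_⟩
  exact Real.rpow_pos_of_pos (abs_pos.2 (sub_ne_zero.2 hj)) _

lemma abs_rpow_le_sqrt_anisoScale {N : ℕ} {H : Fin N → ℝ}
    (s t : EuclideanSpace ℝ (Fin N)) (j : Fin N) :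
    |s j - t j| ^ H j ≤ √(anisoScale H s t) := by
  refine Real.le_sqrt_of_sq_le ?_
  rw [← Real.rpow_natCast, ← Real.rpow_mul (abs_nonneg _), mul_comm]
  exact Finset.single_le_sum (f := fun j => |s j - t j| ^ (2 * H j))
    (fun j _ => by positivity) (Finset.mem_univ j)

/-- Product majorant for the energy kernel against the two-point small ball probability. -/
lemma edist_rpow_mul_le_prod {N p : ℕ} {H : Fin N → ℝ} (hH : ∀ j, 0 < H j) {g : ℝ}
    {a b : Fin N → ℝ} (ha : ∀ j, 0 ≤ a j) (hb : ∀ j, 0 ≤ b j) (hag : ∑ j, a j = g)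
    (hbp : ∑ j, b j = p) {s t : EuclideanSpace ℝ (Fin N)} (hst : s ≠ t) :
    edist s t ^ (-g) * ENNReal.ofReal (√(anisoScale H s t)) ^ (-(p : ℝ)) ≤
      ∏ j, ENNReal.ofReal |s j - t j| ^ (-(a j + H j * b j)) := by
  have h1 : edist s t ^ (-g) ≤ ∏ j, ENNReal.ofReal |s j - t j| ^ (-a j) := by
    rw [← hag]
    refine ENNReal.rpow_neg_sum_le_prod (by simpa using hst) (edist_ne_top _ _) (fun j => ?_) ha
    rw [edist_dist, dist_eq_norm]
    refine ENNReal.ofReal_le_ofReal ?_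
    simpa using PiLp.norm_apply_le (s - t) j
  have h2 : ENNReal.ofReal (√(anisoScale H s t)) ^ (-(p : ℝ)) ≤
      ∏ j, (ENNReal.ofReal |s j - t j| ^ H j) ^ (-b j) := by
    rw [← hbp]
    refine ENNReal.rpow_neg_sum_le_prod ?_ (by simp) (fun j => ?_) hb
    · simpa using anisoScale_pos hst
    · rw [ENNReal.ofReal_rpow_of_nonneg (abs_nonneg _) (hH j).le]
      exact ENNReal.ofReal_le_ofReal (abs_rpow_le_sqrt_anisoScale s t j)
  calc _ ≤ (∏ j, ENNReal.ofReal |s j - t j| ^ (-a j)) *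
        ∏ j, (ENNReal.ofReal |s j - t j| ^ H j) ^ (-b j) := by gcongr
    _ = _ := by
        rw [← Finset.prod_mul_distrib]
        refine Finset.prod_congr rfl fun j _ => ?_
        rw [← ENNReal.rpow_mul, mul_neg, ENNReal.rpow_neg_mul_rpow_neg (by simp) (ha j)
          (mul_nonneg (hH j).le (hb j))]

end Kernel

/-! ### Second moment method for random measures -/

section SecondMoment

open Filter

variable {Ω : Type*} [MeasurableSpace Ω] {P : Measure Ω}

/-- A Paley–Zygmund inequality. -/
lemma le_measure_of_second_moment [IsProbabilityMeasure P] {f : Ω → ENNReal} (hf : Measurable f)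
    {c d : ℝ} (hc : 0 < c) (hd : 0 < d) (h1 : ENNReal.ofReal c ≤ ∫⁻ ω, f ω ∂P)
    (h2 : ∫⁻ ω, f ω * f ω ∂P ≤ ENNReal.ofReal d) :
    ENNReal.ofReal (c ^ 2 / (16 * d)) ≤ P {ω | ENNReal.ofReal (c / 2) ≤ f ω} := by
  set A := {ω | ENNReal.ofReal (c / 2) ≤ f ω} with hA
  have hAm : MeasurableSet A := measurableSet_le measurable_const hf
  set η : ℝ := c / (4 * d) with hη
  have hη0 : 0 < η := by positivity
  -- Off `A`, `f` is below `c / 2`; on `A`, either `f ≤ 1 / η`, or `1 / η ≤ f` and hence `f ≤ η *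
  -- f²`. The choice of `η` makes the quadratic term contribute `c / 4`, leaving `c / 4` for `P A`.
  have hpt : ∀ ω, f ω ≤ ENNReal.ofReal (c / 2) + (ENNReal.ofReal η * (f ω * f ω) +
      A.indicator (fun _ => ENNReal.ofReal (1 / η)) ω) := by
    intro ω
    by_cases hω : ω ∈ A
    · refine le_add_left ?_
      rw [Set.indicator_of_mem hω]
      rcases le_total (f ω) (ENNReal.ofReal (1 / η)) with h | h
      · exact le_add_left h
      · refine le_add_right ?_
        calc f ω = ENNReal.ofReal η * (ENNReal.ofReal (1 / η) * f ω) := by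
              rw [← mul_assoc, ← ENNReal.ofReal_mul hη0.le, mul_one_div_cancel hη0.ne']
              simp
          _ ≤ _ := by gcongr
    · exact le_add_right (not_le.1 hω).le
  have hint : ENNReal.ofReal c ≤ ENNReal.ofReal (c / 2) +
      (ENNReal.ofReal η * ENNReal.ofReal d + ENNReal.ofReal (1 / η) * P A) := by
    calc _ ≤ _ := h1
      _ ≤ _ := lintegral_mono hpt
      _ = ENNReal.ofReal (c / 2) + (ENNReal.ofReal η * (∫⁻ ω, f ω * f ω ∂P) +
          ENNReal.ofReal (1 / η) * P A) := by
          rw [lintegral_add_left measurable_const, lintegral_add_left (by fun_prop),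
            lintegral_const_mul _ (by fun_prop), lintegral_indicator_const hAm, lintegral_const,
            measure_univ, mul_one]
      _ ≤ _ := by gcongr
  have hPA : P A = ENNReal.ofReal (P.real A) := (ofReal_measureReal (measure_ne_top P A)).symm
  rw [hPA] at hint ⊢
  refine ENNReal.ofReal_le_ofReal ?_
  rw [← ENNReal.ofReal_mul hη0.le, ← ENNReal.ofReal_mul (by positivity),
    ← ENNReal.ofReal_add (by positivity) (by positivity),
    ← ENNReal.ofReal_add (by positivity) (by positivity),
    ENNReal.ofReal_le_ofReal_iff (by positivity)] at hint
  have e1 : η * d = c / 4 := by rw [hη]; field_simp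
  have e2 : 1 / η = 4 * d / c := by rw [hη]; field_simp
  rw [e1, e2] at hint
  have h3 : c / 4 ≤ 4 * d / c * P.real A := by linarith
  rw [div_le_iff₀ (by positivity)]
  have h4 : c / 4 * c ≤ 4 * d * P.real A := by
    calc c / 4 * c ≤ 4 * d / c * P.real A * c := by gcongr
      _ = _ := by field_simp
  nlinarith

/-- Continuity from above along the decreasing tail unions; no independence is involved. -/
lemma le_measure_frequently [IsFiniteMeasure P] {A : ℕ → Set Ω} (hA : ∀ n, MeasurableSet (A n))
    {q : ENNReal} (hq : ∀ n, q ≤ P (A n)) :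
    MeasurableSet {ω | ∃ᶠ n in atTop, ω ∈ A n} ∧ q ≤ P {ω | ∃ᶠ n in atTop, ω ∈ A n} := by
  have h : {ω | ∃ᶠ n in atTop, ω ∈ A n} = ⋂ m, ⋃ n ≥ m, A n := by
    ext ω
    simp [frequently_atTop]
  have hm : ∀ m, MeasurableSet (⋃ n ≥ m, A n) := fun m =>
    MeasurableSet.iUnion fun n => MeasurableSet.iUnion fun _ => hA n
  rw [h]
  refine ⟨MeasurableSet.iInter hm, ?_⟩
  have hanti : Antitone fun m => ⋃ n ≥ m, A n := fun m m' hmm' =>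
    Set.iUnion_mono fun n => Set.iUnion_subset fun hn => Set.subset_iUnion_of_subset
      (hmm'.trans hn) subset_rfl
  have ht := tendsto_measure_iInter_atTop (μ := P) (fun m => (hm m).nullMeasurableSet) hanti
    ⟨0, measure_ne_top _ _⟩
  refine ge_of_tendsto' ht fun m => (hq m).trans (measure_mono ?_)
  exact Set.subset_iUnion₂_of_subset m le_rfl subset_rfl

variable {E : Type*} [MeasurableSpace E] {ν : Measure E} [SFinite ν]

lemma lintegral_lintegral_withDensity {f : E → ENNReal} (hf : Measurable f) {w : E → E → ENNReal}
    (hw : Measurable (Function.uncurry w)) :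
    ∫⁻ s, ∫⁻ t, w s t ∂ν.withDensity f ∂ν.withDensity f =
      ∫⁻ s, ∫⁻ t, w s t * (f s * f t) ∂ν ∂ν := by
  have h1 : ∀ s, ∫⁻ t, w s t ∂ν.withDensity f = ∫⁻ t, f t * w s t ∂ν := fun s =>
    lintegral_withDensity_eq_lintegral_mul ν hf (hw.comp measurable_prodMk_left)
  simp_rw [h1]
  have h2 : Measurable fun s => ∫⁻ t, f t * w s t ∂ν :=
    Measurable.lintegral_prod_right ((hf.comp measurable_snd).mul hw)
  rw [lintegral_withDensity_eq_lintegral_mul ν hf h2]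
  refine lintegral_congr fun s => ?_
  have h3 : Measurable fun t => f t * w s t := hf.mul (hw.comp measurable_prodMk_left)
  rw [Pi.mul_apply, ← lintegral_const_mul _ h3]
  refine lintegral_congr fun t => ?_
  ring

lemma measurable_lintegral_lintegral_mul {D : E → Ω → ENNReal}
    (hD : Measurable (Function.uncurry D)) {w : E → E → ENNReal}
    (hw : Measurable (Function.uncurry w)) :
    Measurable fun ω => ∫⁻ s, ∫⁻ t, w s t * (D s ω * D t ω) ∂ν ∂ν := by
  have h1 : Measurable fun z : (Ω × E) × E => w z.1.2 z.2 * (D z.1.2 z.1.1 * D z.2 z.1.1) := by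
    refine (hw.comp (measurable_fst.snd.prodMk measurable_snd)).mul
      ((hD.comp (measurable_fst.snd.prodMk measurable_fst.fst)).mul
        (hD.comp (measurable_snd.prodMk measurable_fst.fst)))
  exact (h1.lintegral_prod_right' (ν := ν)).lintegral_prod_right' (ν := ν)

lemma lintegral_lintegral_lintegral_mul [SFinite P] {D : E → Ω → ENNReal}
    (hD : Measurable (Function.uncurry D)) {w : E → E → ENNReal}
    (hw : Measurable (Function.uncurry w)) :
    ∫⁻ ω, ∫⁻ s, ∫⁻ t, w s t * (D s ω * D t ω) ∂ν ∂ν ∂P =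
      ∫⁻ s, ∫⁻ t, w s t * ∫⁻ ω, D s ω * D t ω ∂P ∂ν ∂ν := by
  have h1 : Measurable fun z : (Ω × E) × E => w z.1.2 z.2 * (D z.1.2 z.1.1 * D z.2 z.1.1) := by
    refine (hw.comp (measurable_fst.snd.prodMk measurable_snd)).mul
      ((hD.comp (measurable_fst.snd.prodMk measurable_fst.fst)).mul
        (hD.comp (measurable_snd.prodMk measurable_fst.fst)))
  rw [lintegral_lintegral_swap (h1.lintegral_prod_right' (ν := ν)).aemeasurable]
  refine lintegral_congr fun s => ?_
  have h2 : Measurable fun z : Ω × E => w s z.2 * (D s z.1 * D z.2 z.1) :=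
    h1.comp ((measurable_fst.prodMk measurable_const).prodMk measurable_snd)
  rw [lintegral_lintegral_swap h2.aemeasurable]
  refine lintegral_congr fun t => ?_
  exact lintegral_const_mul _
    ((hD.comp measurable_prodMk_left).mul (hD.comp measurable_prodMk_left))

end SecondMoment

/-! ### A continuous modification -/

section Modification

variable {N p : ℕ} {Ω : Type*} [MeasurableSpace Ω] {P : Measure Ω}

/-- Composing with the coordinatewise projection onto the cube, and setting the field to zero on a
measurable null set, makes every path continuous everywhere. This gives the joint measurability in
`(t, ω)` needed for Fubini. -/
lemma exists_continuous_modification {Y : Fin p → EuclideanSpace ℝ (Fin N) → Ω → ℝ}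
    (hY : ∀ i t, Measurable (Y i t))
    (hcont : ∀ᵐ ω ∂P, ContinuousOn (fun t => vectorField Y t ω) (cube N 0 1)) :
    ∃ Z : Fin p → EuclideanSpace ℝ (Fin N) → Ω → ℝ, (∀ i t, Measurable (Z i t)) ∧
      (∀ i ω, Continuous fun t => Z i t ω) ∧
      ∀ᵐ ω ∂P, ∀ t ∈ cube N 0 1, ∀ i, Z i t ω = Y i t ω := by
  classical
  obtain ⟨B, hB, hBm, hB0⟩ := exists_measurable_superset_of_null (ae_iff.1 hcont)
  set π : EuclideanSpace ℝ (Fin N) → EuclideanSpace ℝ (Fin N) :=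
    fun t => WithLp.toLp 2 fun j => max 0 (min 1 (t j)) with hπ
  have hπc : Continuous π := by
    simp only [hπ]
    refine (PiLp.continuous_toLp 2 _).comp ?_
    fun_prop
  have hπmem : ∀ t, π t ∈ cube N 0 1 := fun t j =>
    ⟨le_max_left _ _, max_le zero_le_one (min_le_left _ _)⟩
  have hπid : ∀ t ∈ cube N 0 1, π t = t := fun t ht => by
    refine PiLp.ext fun j => ?_
    simp [hπ, (ht j).1, (ht j).2]
  refine ⟨fun i t => Bᶜ.indicator (Y i (π t)), fun i t => (hY i _).indicator hBm.compl,
    fun i ω => ?_, ?_⟩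
  · by_cases hω : ω ∈ B
    · simp [hω, continuous_const]
    · have hc : ContinuousOn (fun t => vectorField Y t ω) (cube N 0 1) := by
        by_contra h
        exact hω (hB h)
      have h1 : Continuous fun t => vectorField Y (π t) ω :=
        hc.comp_continuous hπc hπmem
      have h2 : Continuous fun t => vectorField Y (π t) ω i :=
        (EuclideanSpace.proj (𝕜 := ℝ) i).continuous.comp h1
      simpa [hω, vectorField] using h2
  · have : ∀ᵐ ω ∂P, ω ∉ B := measure_eq_zero_iff_ae_notMem.1 hB0
    filter_upwards [this] with ω hω t ht i
    simp [hω, hπid t ht]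

end Modification

/-! ### Lower bound for the dimension of level sets -/

section LowerBound

open Filter

variable {N p : ℕ} {Ω₀ Ω : Type*} [MeasurableSpace Ω₀] [MeasurableSpace Ω]
  {P₀ : Measure Ω₀} {P : Measure Ω} {X : EuclideanSpace ℝ (Fin N) → Ω₀ → ℝ}
  {Y : Fin p → EuclideanSpace ℝ (Fin N) → Ω → ℝ} {H : Fin N → ℝ}

/-- The density (at scale `r`) of the mollified occupation measure at level `x`. -/
noncomputable def nearDensity (Z : Fin p → EuclideanSpace ℝ (Fin N) → Ω → ℝ) (x : Fin p → ℝ)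
    (r : ℝ) (t : EuclideanSpace ℝ (Fin N)) : Ω → ENNReal :=
  {ω | ∀ i, |Z i t ω - x i| ≤ r}.indicator fun _ => (ENNReal.ofReal r ^ p)⁻¹

lemma measurable_nearDensity {Z : Fin p → EuclideanSpace ℝ (Fin N) → Ω → ℝ}
    (hZ : ∀ i t, Measurable (Z i t)) (hZc : ∀ i ω, Continuous fun t => Z i t ω)
    (x : Fin p → ℝ) (r : ℝ) : Measurable (Function.uncurry (nearDensity Z x r)) := by
  have h : ∀ i, Measurable (Function.uncurry (Z i)) := fun i =>
    measurable_uncurry_of_continuous_of_measurable (hZc i) (hZ i)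
  have hset : MeasurableSet {z : EuclideanSpace ℝ (Fin N) × Ω | ∀ i, |Z i z.1 z.2 - x i| ≤ r} := by
    have : {z : EuclideanSpace ℝ (Fin N) × Ω | ∀ i, |Z i z.1 z.2 - x i| ≤ r} =
        ⋂ i, {z | |Z i z.1 z.2 - x i| ≤ r} := by ext; simp
    rw [this]
    exact MeasurableSet.iInter fun i =>
      measurableSet_le (((h i).sub measurable_const).norm) measurable_const
  exact Measurable.indicator (f := fun _ => (ENNReal.ofReal r ^ p)⁻¹) measurable_const hset

lemma volume_cube_half_ne_zero (N : ℕ) :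
    (volume : Measure (EuclideanSpace ℝ (Fin N))) (cube N (1 / 2) 1) ≠ 0 := by
  have hpre : cube N (1 / 2) 1 = (WithLp.ofLp : EuclideanSpace ℝ (Fin N) → Fin N → ℝ) ⁻¹'
      (Set.univ.pi fun _ => Set.Icc (1 / 2) 1) := by
    ext t
    simp only [cube, Set.mem_ofPred_eq, Set.mem_preimage, Set.mem_univ_pi]
  rw [hpre, (PiLp.volume_preserving_ofLp (Fin N)).measure_preimage
    (MeasurableSet.univ_pi fun _ => measurableSet_Icc).nullMeasurableSet, volume_pi_pi,
    Finset.prod_ne_zero_iff]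
  intro j _
  rw [Real.volume_Icc]
  norm_num

lemma volume_cube_ne_top (a b : ℝ) :
    (volume : Measure (EuclideanSpace ℝ (Fin N))) (cube N a b) ≠ ⊤ :=
  (isCompact_cube a b).measure_lt_top.ne

lemma measurableSet_cube (a b : ℝ) : MeasurableSet (cube N a b) :=
  (isCompact_cube a b).isClosed.measurableSet

/-- Uniform bound for the expected energy of the mollified occupation measures. -/
lemma exists_energy_bound [NeZero N] (hH : ∀ j, 0 < H j)
    (hX : IsCenteredGaussianField X P₀) (hD2 : ConditionD2 H X P₀)
    (hY : AreIndependentCopies Y P X P₀) {Z : Fin p → EuclideanSpace ℝ (Fin N) → Ω → ℝ}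
    (hZ : ∀ i t, Measurable (Z i t)) (hZY : ∀ᵐ ω ∂P, ∀ t ∈ cube N 0 1, ∀ i, Z i t ω = Y i t ω)
    (hQ : (p : ℝ) < ∑ j, 1 / H j) (x : Fin p → ℝ) {g : ℝ} (hg0 : 0 ≤ g) (hg : g < levelDim H p) :
    ∃ d : ℝ, 0 < d ∧ ∀ r : ℝ, 0 < r →
      ∫⁻ s in cube N (1 / 2) 1, ∫⁻ t in cube N (1 / 2) 1, edist s t ^ (-g) *
        ∫⁻ ω, nearDensity Z x r s ω * nearDensity Z x r t ω ∂P ≤ ENNReal.ofReal d := by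
  obtain ⟨a, b, ha, hb, hag, hbp, hab⟩ := exists_exponents hH hQ hg0 hg
  obtain ⟨C, hC, hCle⟩ := exists_lintegral_prod_kernel_le (θ := fun j => a j + H j * b j) hab
  obtain ⟨v, hv, hvar⟩ := exists_le_variance hX hH hD2
  obtain ⟨c, hc, hcond⟩ := hD2 (1 / 2) (by norm_num)
  set K : ENNReal := (ENNReal.ofReal (2 / √v) * ENNReal.ofReal (2 / √c)) ^ p with hK
  have hKtop : K ≠ ⊤ := by finiteness
  have hsub : cube N (1 / 2) 1 ⊆ cube N 0 1 := cube_mono (by norm_num)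
  have hpair : ∀ r : ℝ, 0 < r → ∀ s ∈ cube N (1 / 2) 1, ∀ t ∈ cube N (1 / 2) 1, s ≠ t →
      edist s t ^ (-g) * ∫⁻ ω, nearDensity Z x r s ω * nearDensity Z x r t ω ∂P ≤
        K * ∏ j, ENNReal.ofReal |s j - t j| ^ (-(a j + H j * b j)) := by
    intro r hr s hs t ht hst
    have hA : 0 < anisoScale H s t := anisoScale_pos hst
    have hA' : anisoScale H t s = anisoScale H s t := by
      simp only [anisoScale]
      exact Finset.sum_congr rfl fun j _ => by rw [abs_sub_comm]
    have hms : ∀ t, MeasurableSet {ω | ∀ i, |Z i t ω - x i| ≤ r} := fun t => by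
      have : {ω | ∀ i, |Z i t ω - x i| ≤ r} = ⋂ i, {ω | |Z i t ω - x i| ≤ r} := by ext; simp
      rw [this]
      exact MeasurableSet.iInter fun i =>
        measurableSet_le (((hZ i t).sub measurable_const).norm) measurable_const
    have hint : ∫⁻ ω, nearDensity Z x r s ω * nearDensity Z x r t ω ∂P =
        (ENNReal.ofReal r ^ p)⁻¹ * (ENNReal.ofReal r ^ p)⁻¹ *
          P {ω | (∀ i, |Y i s ω - x i| ≤ r) ∧ ∀ i, |Y i t ω - x i| ≤ r} := by
      have h1 : ∀ ω, nearDensity Z x r s ω * nearDensity Z x r t ω =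
          ({ω | ∀ i, |Z i s ω - x i| ≤ r} ∩ {ω | ∀ i, |Z i t ω - x i| ≤ r}).indicator
            (fun _ => (ENNReal.ofReal r ^ p)⁻¹ * (ENNReal.ofReal r ^ p)⁻¹) ω := by
        intro ω
        simp only [nearDensity]
        rw [Set.inter_indicator_mul]
      simp_rw [h1]
      rw [lintegral_indicator_const ((hms s).inter (hms t))]
      congr 1
      refine measure_congr ?_
      filter_upwards [hZY] with ω hω
      refine propext ?_
      change ((∀ i, |Z i s ω - x i| ≤ r) ∧ ∀ i, |Z i t ω - x i| ≤ r) ↔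
        ((∀ i, |Y i s ω - x i| ≤ r) ∧ ∀ i, |Y i t ω - x i| ≤ r)
      simp only [hω s (hsub hs), hω t (hsub ht)]
    have hprob := measure_near_near_le hX hY hv (mul_pos hc hA) (hvar s hs)
      (by simpa only [hA'] using hcond t ht s hs) x hr.le
    have hr0 : ENNReal.ofReal r ≠ 0 := by simpa using hr
    have hsq : 0 < √(anisoScale H s t) := Real.sqrt_pos.2 hA
    -- The two normalizations `r ^ (-p)` cancel the factor `r ^ (2 * p)` of the two-point estimate,
    -- so the bound is uniform in `r`.
    have hscale : (ENNReal.ofReal r ^ p)⁻¹ * (ENNReal.ofReal r ^ p)⁻¹ *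
        (ENNReal.ofReal (2 * r / √v) * ENNReal.ofReal (2 * r / √(c * anisoScale H s t))) ^ p =
        K * ENNReal.ofReal (√(anisoScale H s t)) ^ (-(p : ℝ)) := by
      have e1 : ENNReal.ofReal (2 * r / √v) = ENNReal.ofReal (2 / √v) * ENNReal.ofReal r := by
        rw [← ENNReal.ofReal_mul (by positivity)]
        congr 1
        ring
      have e2 : ENNReal.ofReal (2 * r / √(c * anisoScale H s t)) =
          ENNReal.ofReal (2 / √c) * ENNReal.ofReal r *
            (ENNReal.ofReal (√(anisoScale H s t)))⁻¹ := by
        rw [← ENNReal.ofReal_inv_of_pos hsq, ← ENNReal.ofReal_mul (by positivity),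
          ← ENNReal.ofReal_mul (by positivity), Real.sqrt_mul hc.le]
        congr 1
        field_simp
      have hrp0 : ENNReal.ofReal r ^ p ≠ 0 := pow_ne_zero _ hr0
      have hrpt : ENNReal.ofReal r ^ p ≠ ⊤ := by finiteness
      have e3 : (ENNReal.ofReal (√(anisoScale H s t)) ^ p)⁻¹ =
          (ENNReal.ofReal (√(anisoScale H s t)))⁻¹ ^ p := ENNReal.inv_pow
      rw [e1, e2, ENNReal.rpow_neg, ENNReal.rpow_natCast, hK, mul_pow, mul_pow, mul_pow, mul_pow,
        mul_pow, e3]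
      calc _ = ((ENNReal.ofReal r ^ p)⁻¹ * ENNReal.ofReal r ^ p) *
            ((ENNReal.ofReal r ^ p)⁻¹ * ENNReal.ofReal r ^ p) *
            (ENNReal.ofReal (2 / √v) ^ p * ENNReal.ofReal (2 / √c) ^ p *
              (ENNReal.ofReal (√(anisoScale H s t)))⁻¹ ^ p) := by ring
        _ = _ := by rw [ENNReal.inv_mul_cancel hrp0 hrpt, one_mul, one_mul]
    calc _ ≤ edist s t ^ (-g) * (K * ENNReal.ofReal (√(anisoScale H s t)) ^ (-(p : ℝ))) := by
          rw [hint, ← hscale]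
          gcongr
      _ = K * (edist s t ^ (-g) * ENNReal.ofReal (√(anisoScale H s t)) ^ (-(p : ℝ))) := by ring
      _ ≤ _ := by
          gcongr
          exact edist_rpow_mul_le_prod hH ha hb hag hbp hst
  have hfin : K * C * volume (cube N 0 1) ≠ ⊤ :=
    ENNReal.mul_ne_top (ENNReal.mul_ne_top hKtop hC) (volume_cube_ne_top 0 1)
  refine ⟨(K * C * volume (cube N 0 1)).toReal + 1, by positivity, fun r hr => ?_⟩
  calc _ ≤ ∫⁻ _ in cube N (1 / 2) 1, K * C := by
        refine setLIntegral_mono' (measurableSet_cube _ _) fun s hs => ?_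
        calc _ ≤ ∫⁻ t in cube N (1 / 2) 1,
                K * ∏ j, ENNReal.ofReal |s j - t j| ^ (-(a j + H j * b j)) := by
              -- The pointwise bound needs `s ≠ t`; the diagonal point is Lebesgue-null.
              refine lintegral_mono_ae ?_
              have hne : ∀ᵐ t ∂(volume : Measure (EuclideanSpace ℝ (Fin N))), t ≠ s := by
                simp [ae_iff]
              filter_upwards [ae_restrict_of_ae hne, ae_restrict_mem (measurableSet_cube _ _)]
                with t hts ht
              exact hpair r hr s hs t ht hts.symm
          _ = K * ∫⁻ t in cube N (1 / 2) 1,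
                ∏ j, ENNReal.ofReal |s j - t j| ^ (-(a j + H j * b j)) :=
              lintegral_const_mul _ (by fun_prop)
          _ ≤ K * C := by
              gcongr
              exact (lintegral_mono_set hsub).trans (hCle s (hsub hs))
    _ ≤ K * C * volume (cube N 0 1) := by
        rw [setLIntegral_const]
        gcongr
    _ ≤ _ := by
        rw [ENNReal.ofReal_add (by positivity) zero_le_one, ENNReal.ofReal_toReal hfin]
        exact le_self_add

/-- Uniform lower bound for the expected mass of the mollified occupation measures. -/
lemma exists_mass_bound [NeZero N] (hH : ∀ j, 0 < H j)
    (hX : IsCenteredGaussianField X P₀) (hD1 : ConditionD1 H X P₀) (hD2 : ConditionD2 H X P₀)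
    (hY : AreIndependentCopies Y P X P₀) {Z : Fin p → EuclideanSpace ℝ (Fin N) → Ω → ℝ}
    (hZ : ∀ i t, Measurable (Z i t)) (hZY : ∀ᵐ ω ∂P, ∀ t ∈ cube N 0 1, ∀ i, Z i t ω = Y i t ω)
    (x : Fin p → ℝ) :
    ∃ c : ℝ, 0 < c ∧ ∀ r : ℝ, 0 < r → r ≤ 1 →
      ENNReal.ofReal c ≤ ∫⁻ t in cube N (1 / 2) 1, ∫⁻ ω, nearDensity Z x r t ω ∂P := by
  obtain ⟨v, hv, hvar⟩ := exists_le_variance hX hH hD2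
  obtain ⟨b, hb, hvarb⟩ := exists_variance_le hH hX hD1
  obtain ⟨C, hC, hCle⟩ := le_measure_near hX hY hv hb x
  have hsub : cube N (1 / 2) 1 ⊆ cube N 0 1 := cube_mono (by norm_num)
  set m := C * volume (cube N (1 / 2) 1) with hm
  have hm0 : m ≠ 0 := mul_ne_zero hC (volume_cube_half_ne_zero N)
  have hmin : min m 1 ≠ ⊤ := ne_top_of_le_ne_top ENNReal.one_ne_top (min_le_right _ _)
  -- The constant `C` is only known to be nonzero; the minimum with `1` guarantees finiteness.
  refine ⟨(min m 1).toReal, ENNReal.toReal_pos (by simp [hm0]) hmin, fun r hr hr1 => ?_⟩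
  rw [ENNReal.ofReal_toReal hmin]
  refine (min_le_left _ _).trans ?_
  rw [hm, ← setLIntegral_const]
  refine setLIntegral_mono' (measurableSet_cube _ _) fun t ht => ?_
  have hms : MeasurableSet {ω | ∀ i, |Z i t ω - x i| ≤ r} := by
    have : {ω | ∀ i, |Z i t ω - x i| ≤ r} = ⋂ i, {ω | |Z i t ω - x i| ≤ r} := by ext; simp
    rw [this]
    exact MeasurableSet.iInter fun i =>
      measurableSet_le (((hZ i t).sub measurable_const).norm) measurable_const
  have hPZ : P {ω | ∀ i, |Z i t ω - x i| ≤ r} = P {ω | ∀ i, |Y i t ω - x i| ≤ r} := by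
    refine measure_congr ?_
    filter_upwards [hZY] with ω hω
    refine propext ?_
    change (∀ i, |Z i t ω - x i| ≤ r) ↔ (∀ i, |Y i t ω - x i| ≤ r)
    simp only [hω t (hsub ht)]
  have hr0 : ENNReal.ofReal r ^ p ≠ 0 := pow_ne_zero _ (by simpa using hr)
  simp only [nearDensity]
  rw [lintegral_indicator_const hms, hPZ]
  calc C = (ENNReal.ofReal r ^ p)⁻¹ * (C * ENNReal.ofReal r ^ p) := by
        rw [mul_comm C, ← mul_assoc, ENNReal.inv_mul_cancel hr0 (by finiteness), one_mul]
    _ ≤ _ := by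
        gcongr
        exact hCle t (hvar t ht) (hvarb t (hsub ht)) r hr.le hr1

/-- On the compact set `T \ U` the continuous function `∑ |y i - x i|` has a positive minimum, so no
point there is `1 / (n + 1)`-close to the level for large `n`. Hence the mollified measures
eventually give no mass to `Uᶜ`. -/
lemma eventually_withDensity_compl_eq_zero {y : Fin p → EuclideanSpace ℝ (Fin N) → ℝ}
    (hy : ∀ i, Continuous (y i)) (x : Fin p → ℝ) {T : Set (EuclideanSpace ℝ (Fin N))}
    (hT : IsCompact T) {U : Set (EuclideanSpace ℝ (Fin N))} (hU : IsOpen U)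
    (hTU : {t | t ∈ T ∧ ∀ i, y i t = x i} ⊆ U) :
    ∀ᶠ n : ℕ in atTop, ∀ t ∈ T \ U, ¬ ∀ i, |y i t - x i| ≤ 1 / ((n : ℝ) + 1) := by
  rcases (T \ U).eq_empty_or_nonempty with h | h
  · simp [h]
  obtain ⟨t₀, ht₀, hmin⟩ := (hT.diff hU).exists_isMinOn h
    (f := fun t => ∑ i, |y i t - x i|) (by fun_prop)
  have hpos : 0 < ∑ i, |y i t₀ - x i| := by
    refine lt_of_le_of_ne (Finset.sum_nonneg fun i _ => abs_nonneg _) fun h0 => ht₀.2 (hTU ?_)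
    refine ⟨ht₀.1, fun i => ?_⟩
    have := (Finset.sum_eq_zero_iff_of_nonneg fun i _ => abs_nonneg (y i t₀ - x i)).1 h0.symm i
      (Finset.mem_univ i)
    exact sub_eq_zero.1 (abs_eq_zero.1 this)
  have hlim : Tendsto (fun n : ℕ => (p : ℝ) * (1 / ((n : ℝ) + 1))) atTop (nhds (p * 0)) :=
    tendsto_one_div_add_atTop_nhds_zero_nat.const_mul _
  rw [mul_zero] at hlim
  filter_upwards [hlim.eventually_lt_const hpos] with n hn t ht hle
  have h1 : ∑ i, |y i t₀ - x i| ≤ ∑ i, |y i t - x i| := hmin ht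
  have h2 : ∑ i, |y i t - x i| ≤ ∑ _i : Fin p, 1 / ((n : ℝ) + 1) :=
    Finset.sum_le_sum fun i _ => hle i
  simp only [Finset.sum_const, Finset.card_univ, Fintype.card_fin, nsmul_eq_mul] at h2
  linarith

/-- By monotonicity `∑_{j > k} H k / H j ≤ N - k - 1` (in the zero-based index), so the `k`-th
expression is at least `H k * (∑ 1 / H j - p)`. -/
lemma levelDim_pos [NeZero N] (hH : ∀ j, 0 < H j) (hmono : Monotone H)
    (hQ : (p : ℝ) < ∑ j, 1 / H j) : 0 < levelDim H p := by
  rw [levelDim, Finset.lt_inf'_iff]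
  intro k _
  have h1 : ∑ j, 1 / H j ≤ ∑ j ∈ Finset.Iic k, 1 / H j + ((N : ℝ) - ((k : ℕ) + 1)) * (1 / H k) := by
    have hsplit : ∑ j, 1 / H j = ∑ j ∈ Finset.Iic k, 1 / H j + ∑ j ∈ Finset.Ioi k, 1 / H j := by
      rw [← Finset.sum_union]
      · congr 1
        ext j
        simpa using le_or_gt j k
      · rw [Finset.disjoint_left]
        intro j hj hj'
        exact absurd (Finset.mem_Iic.1 hj) (not_le.2 (Finset.mem_Ioi.1 hj'))
    have hcard : ∑ j ∈ Finset.Ioi k, 1 / H j ≤ ∑ _j ∈ Finset.Ioi k, 1 / H k :=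
      Finset.sum_le_sum fun j hj =>
        one_div_le_one_div_of_le (hH k) (hmono (Finset.mem_Ioi.1 hj).le)
    rw [hsplit]
    have hk : ((N - 1 - (k : ℕ) : ℕ) : ℝ) = (N : ℝ) - ((k : ℕ) + 1) := by
      have := k.2
      rw [Nat.sub_sub, Nat.cast_sub (by omega)]
      push_cast
      ring
    rw [Finset.sum_const, Fin.card_Ioi, nsmul_eq_mul, hk] at hcard
    linarith
  have h2 : ∑ j ∈ Finset.Iic k, H k / H j = H k * ∑ j ∈ Finset.Iic k, 1 / H j := by
    rw [Finset.mul_sum]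
    exact Finset.sum_congr rfl fun j _ => by ring
  have h3 : H k * p < H k * (∑ j ∈ Finset.Iic k, 1 / H j +
      ((N : ℝ) - ((k : ℕ) + 1)) * (1 / H k)) := mul_lt_mul_of_pos_left (hQ.trans_le h1) (hH k)
  rw [h2]
  have h4 : H k * (((N : ℝ) - ((k : ℕ) + 1)) * (1 / H k)) = (N : ℝ) - ((k : ℕ) + 1) := by
    have := (hH k).ne'
    field_simp
  rw [mul_add, h4] at h3
  linarith

/-- With a probability bounded below independently of `g < levelDim H p`, the level set has
positive `g`-dimensional Hausdorff measure. -/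
lemma exists_prob_hausdorffMeasure_ne_zero [NeZero N] [IsProbabilityMeasure P]
    (hH : ∀ j, 0 < H j) (hmono : Monotone H)
    (hX : IsCenteredGaussianField X P₀) (hD1 : ConditionD1 H X P₀) (hD2 : ConditionD2 H X P₀)
    (hY : AreIndependentCopies Y P X P₀)
    (hcont : ∀ᵐ ω ∂P, ContinuousOn (fun t => vectorField Y t ω) (cube N 0 1))
    (hQ : (p : ℝ) < ∑ j, 1 / H j) (x : EuclideanSpace ℝ (Fin p)) :
    ∃ q : ℝ, 0 < q ∧ ∀ g : ℝ, 0 < g → g < levelDim H p → ∃ A : Set Ω, MeasurableSet A ∧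
      ENNReal.ofReal q ≤ P A ∧ ∀ᵐ ω ∂P, ω ∈ A → μH[g] (levelSet Y x ω) ≠ 0 := by
  obtain ⟨Z, hZ, hZc, hZY⟩ := exists_continuous_modification hY.measurable hcont
  obtain ⟨c, hc, hcle⟩ := exists_mass_bound hH hX hD1 hD2 hY hZ hZY x
  -- The energy for `g = 0` is the second moment of the total mass, so `d`, and with it `q`, is
  -- fixed before `g` is chosen.
  obtain ⟨d, hd, hdle⟩ := exists_energy_bound hH hX hD2 hY hZ hZY hQ x le_rfl
    (levelDim_pos hH hmono hQ)
  -- Half of the Paley–Zygmund probability; the other half pays for discarding the event that the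
  -- energy reaches `e / q`, whose probability is at most `q` by Markov.
  set q : ℝ := c ^ 2 / (16 * d) / 2 with hq
  have hq0 : 0 < q := by positivity
  refine ⟨q, hq0, fun g hg0 hg => ?_⟩
  obtain ⟨e, he, hele⟩ := exists_energy_bound hH hX hD2 hY hZ hZY hQ x hg0.le hg
  set T := cube N (1 / 2) 1 with hT
  set ν : Measure (EuclideanSpace ℝ (Fin N)) := volume.restrict T with hν
  set r : ℕ → ℝ := fun n => 1 / ((n : ℝ) + 1) with hr
  have hr0 : ∀ n, 0 < r n := fun n => Nat.one_div_pos_of_nat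
  have hr1 : ∀ n, r n ≤ 1 := fun n => by
    rw [hr]; simp only; rw [div_le_one (by positivity)]; linarith [(Nat.cast_nonneg n : (0 : ℝ) ≤ n)]
  set D : ℕ → EuclideanSpace ℝ (Fin N) → Ω → ENNReal := fun n => nearDensity Z x (r n) with hD
  have hDm : ∀ n, Measurable (Function.uncurry (D n)) := fun n => measurable_nearDensity hZ hZc x _
  have hDω : ∀ n ω, Measurable fun t => D n t ω := fun n ω => (hDm n).comp measurable_prodMk_right
  set w : EuclideanSpace ℝ (Fin N) → EuclideanSpace ℝ (Fin N) → ENNReal :=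
    fun s t => edist s t ^ (-g) with hw
  have hwm : Measurable (Function.uncurry w) := by
    simp only [hw, Function.uncurry_def]
    exact (measurable_edist).pow_const _
  set F : ℕ → Ω → ENNReal := fun n ω => ∫⁻ t, D n t ω ∂ν with hF
  set G : ℕ → Ω → ENNReal := fun n ω => ∫⁻ s, ∫⁻ t, w s t * (D n s ω * D n t ω) ∂ν ∂ν with hG
  have hFm : ∀ n, Measurable (F n) := fun n => (hDm n).lintegral_prod_left
  have hGm : ∀ n, Measurable (G n) := fun n => measurable_lintegral_lintegral_mul (hDm n) hwm
  set A : ℕ → Set Ω := fun n => {ω | ENNReal.ofReal (c / 2) ≤ F n ω} \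
    {ω | ENNReal.ofReal (e / q) ≤ G n ω} with hA
  have hAm : ∀ n, MeasurableSet (A n) := fun n =>
    (measurableSet_le measurable_const (hFm n)).diff (measurableSet_le measurable_const (hGm n))
  have hAP : ∀ n, ENNReal.ofReal q ≤ P (A n) := by
    intro n
    have h1 : ENNReal.ofReal c ≤ ∫⁻ ω, F n ω ∂P := by
      rw [hF]
      simp only
      rw [lintegral_lintegral_swap (f := fun ω t => D n t ω)
        ((hDm n).comp measurable_swap).aemeasurable]
      exact hcle (r n) (hr0 n) (hr1 n)
    have h2 : ∫⁻ ω, F n ω * F n ω ∂P ≤ ENNReal.ofReal d := by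
      have h3 : ∀ ω, F n ω * F n ω = ∫⁻ s, ∫⁻ t, (fun _ _ => (1 : ENNReal)) s t *
          (D n s ω * D n t ω) ∂ν ∂ν := by
        intro ω
        simp only [hF, one_mul]
        rw [← lintegral_mul_const _ (hDω n ω)]
        refine lintegral_congr fun s => ?_
        rw [lintegral_const_mul _ (hDω n ω)]
      simp_rw [h3]
      rw [lintegral_lintegral_lintegral_mul (hDm n) (w := fun _ _ => 1)
        (by simp [Function.uncurry_def])]
      have := hdle (r n) (hr0 n)
      simpa using this
    have h4 := le_measure_of_second_moment (hFm n) hc hd h1 h2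
    have h5 : P {ω | ENNReal.ofReal (e / q) ≤ G n ω} ≤ ENNReal.ofReal q := by
      refine (meas_ge_le_lintegral_div (hGm n).aemeasurable
        (by simp; positivity) (by simp)).trans ?_
      rw [hG]
      simp only
      rw [lintegral_lintegral_lintegral_mul (hDm n) hwm]
      refine (ENNReal.div_le_div_right (hele (r n) (hr0 n)) _).trans ?_
      rw [← ENNReal.ofReal_div_of_pos (by positivity)]
      refine ENNReal.ofReal_le_ofReal (le_of_eq ?_)
      field_simp
    calc ENNReal.ofReal q = ENNReal.ofReal (c ^ 2 / (16 * d)) - ENNReal.ofReal q := by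
          rw [← ENNReal.ofReal_sub _ hq0.le]
          congr 1
          rw [hq]
          ring
      _ ≤ P {ω | ENNReal.ofReal (c / 2) ≤ F n ω} - P {ω | ENNReal.ofReal (e / q) ≤ G n ω} :=
          tsub_le_tsub h4 h5
      _ ≤ P (A n) := le_measure_sdiff
  obtain ⟨hBm, hBP⟩ := le_measure_frequently hAm hAP
  refine ⟨_, hBm, hBP, ?_⟩
  filter_upwards [hZY] with ω hω hfreq
  have hTc : IsCompact T := isCompact_cube _ _
  have hsub : {t | t ∈ T ∧ ∀ i, Z i t ω = x i} ⊆ levelSet Y x ω := by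
    intro t ht
    have ht1 : t ∈ cube N 0 1 := cube_mono (by norm_num) ht.1
    refine ⟨ht1, PiLp.ext fun i => ?_⟩
    simp only [vectorField]
    rw [← hω t ht1 i]
    exact ht.2 i
  intro h0
  refine hausdorffMeasure_ne_zero_of_energy_le hg0 (fun n => ν.withDensity fun t => D n t ω)
    (K := {t | t ∈ T ∧ ∀ i, Z i t ω = x i}) (a := c / 2) (M := e / q) ?_ (by positivity)
    (by positivity) ?_ (measure_mono_null hsub h0)
  · intro U hU hKU
    filter_upwards [eventually_withDensity_compl_eq_zero (fun i => hZc i ω) x hTc hU hKU] with n hn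
    rw [withDensity_apply _ hU.isClosed_compl.measurableSet, hν,
      Measure.restrict_restrict hU.isClosed_compl.measurableSet]
    rw [setLIntegral_eq_zero_iff (hU.isClosed_compl.measurableSet.inter (measurableSet_cube _ _))
      (hDω n ω)]
    refine Eventually.of_forall fun t ht => ?_
    have hne : ω ∉ {ω | ∀ i, |Z i t ω - x i| ≤ r n} := hn t ⟨ht.2, ht.1⟩
    exact Set.indicator_of_notMem hne _
  · refine hfreq.mono fun n hn => ⟨?_, ?_⟩
    · rw [withDensity_apply _ MeasurableSet.univ, Measure.restrict_univ]
      exact hn.1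
    · refine (le_of_eq ?_).trans (not_le.1 hn.2).le
      exact lintegral_lintegral_withDensity (hDω n ω) hwm

/-- With positive probability the level set has dimension at least `levelDim H p`. -/
theorem exists_prob_levelDim_le_dimH [NeZero N] [IsProbabilityMeasure P]
    (hH : ∀ j, 0 < H j) (hmono : Monotone H)
    (hX : IsCenteredGaussianField X P₀) (hD1 : ConditionD1 H X P₀) (hD2 : ConditionD2 H X P₀)
    (hY : AreIndependentCopies Y P X P₀)
    (hcont : ∀ᵐ ω ∂P, ContinuousOn (fun t => vectorField Y t ω) (cube N 0 1))
    (hQ : (p : ℝ) < ∑ j, 1 / H j) (x : EuclideanSpace ℝ (Fin p)) :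
    ∃ A : Set Ω, MeasurableSet A ∧ 0 < P A ∧
      ∀ᵐ ω ∂P, ω ∈ A → ENNReal.ofReal (levelDim H p) ≤ dimH (levelSet Y x ω) := by
  obtain ⟨q, hq, h⟩ := exists_prob_hausdorffMeasure_ne_zero hH hmono hX hD1 hD2 hY hcont hQ x
  have hL := levelDim_pos hH hmono hQ
  -- The events for different `g n` need not be nested, but infinitely many of them occur with
  -- probability at least `q`, and this suffices to pass to the limit.
  obtain ⟨g, -, hg, hglim⟩ := exists_seq_strictMono_tendsto' hL
  choose A hAm hAP hA using fun n => h (g n) (hg n).1 (hg n).2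
  obtain ⟨hBm, hBP⟩ := le_measure_frequently hAm hAP
  refine ⟨_, hBm, (ENNReal.ofReal_pos.2 hq).trans_le hBP, ?_⟩
  filter_upwards [ae_all_iff.2 hA] with ω hω hfreq
  refine le_of_tendsto_of_frequently (ENNReal.tendsto_ofReal hglim) (hfreq.mono fun n hn => ?_)
  have h1 := hω n hn
  have h2 : ((g n).toNNReal : ℝ) = g n := Real.coe_toNNReal _ (hg n).1.le
  rw [← h2] at h1
  exact le_dimH_of_hausdorffMeasure_ne_zero h1

end LowerBound

/-! ### Anisotropic dyadic grids and chaining -/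

section Grid

open Filter Topology

variable {N : ℕ}

/-- The dyadic order of the `n`-th grid in direction `j`. -/
noncomputable def gridOrder (h : Fin N → ℝ) (n : ℕ) (j : Fin N) : ℕ := ⌈(n : ℝ) / h j⌉₊

/-- The index of the `n`-th generation box containing `t`. -/
noncomputable def gridIndex (h : Fin N → ℝ) (n : ℕ) (t : EuclideanSpace ℝ (Fin N)) (j : Fin N) :
    ℕ := ⌊t j * 2 ^ gridOrder h n j⌋₊

/-- The corner of the `n`-th generation box with index `i`. -/
noncomputable def gridPoint (h : Fin N → ℝ) (n : ℕ) (i : Fin N → ℕ) : EuclideanSpace ℝ (Fin N) :=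
  WithLp.toLp 2 fun j => (i j : ℝ) / 2 ^ gridOrder h n j

/-- The indices of the `n`-th generation boxes meeting the unit cube. -/
noncomputable def gridIndices (h : Fin N → ℝ) (n : ℕ) : Finset (Fin N → ℕ) :=
  Fintype.piFinset fun j => Finset.range (2 ^ gridOrder h n j + 1)

lemma dist_le_sqrt_mul {s t : EuclideanSpace ℝ (Fin N)} {e : ℝ} (he : 0 ≤ e)
    (h : ∀ j, |s j - t j| ≤ e) : dist s t ≤ √N * e := by
  rw [EuclideanSpace.dist_eq]
  refine Real.sqrt_le_iff.2 ⟨by positivity, ?_⟩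
  calc ∑ j, dist (s j) (t j) ^ 2 ≤ ∑ _j : Fin N, e ^ 2 :=
        Finset.sum_le_sum fun j _ => by rw [Real.dist_eq]; gcongr; exact h j
    _ = _ := by rw [mul_pow, Real.sq_sqrt (by positivity)]; simp

variable {h : Fin N → ℝ}

lemma gridIndex_mem {n : ℕ} {t : EuclideanSpace ℝ (Fin N)} (ht : t ∈ cube N 0 1) :
    gridIndex h n t ∈ gridIndices h n := by
  simp only [gridIndices, Fintype.mem_piFinset, Finset.mem_range, Nat.lt_succ_iff]
  intro j
  refine Nat.floor_le_of_le ?_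
  push_cast
  exact mul_le_of_le_one_left (by positivity) (ht j).2

lemma gridPoint_mem {n : ℕ} {i : Fin N → ℕ} (hi : i ∈ gridIndices h n) :
    gridPoint h n i ∈ cube N 0 1 := by
  simp only [gridIndices, Fintype.mem_piFinset, Finset.mem_range, Nat.lt_succ_iff] at hi
  intro j
  simp only [gridPoint]
  refine ⟨by positivity, (div_le_one (by positivity)).2 (by exact_mod_cast hi j)⟩

lemma inv_two_pow_gridOrder_le (n : ℕ) (j : Fin N) :
    ((2 : ℝ) ^ gridOrder h n j)⁻¹ ≤ 2 ^ (-((n : ℝ) / h j)) := by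
  rw [Real.rpow_neg zero_le_two, ← Real.rpow_natCast]
  refine inv_anti₀ (by positivity) (Real.rpow_le_rpow_of_exponent_le one_le_two (Nat.le_ceil _))

lemma gridPoint_gridIndex_le (n : ℕ) {t : EuclideanSpace ℝ (Fin N)}
    (ht : t ∈ cube N 0 1) (j : Fin N) :
    gridPoint h n (gridIndex h n t) j ≤ t j ∧
      t j ≤ gridPoint h n (gridIndex h n t) j + ((2 : ℝ) ^ gridOrder h n j)⁻¹ := by
  simp only [gridPoint, gridIndex]
  have h2 : (0 : ℝ) < 2 ^ gridOrder h n j := by positivity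
  have h0 : 0 ≤ t j * 2 ^ gridOrder h n j := mul_nonneg (ht j).1 h2.le
  constructor
  · rw [div_le_iff₀ h2]
    exact Nat.floor_le h0
  · rw [← one_div, ← add_div, le_div_iff₀ h2]
    exact (Nat.lt_floor_add_one _).le

lemma abs_sub_gridPoint_le (n : ℕ) {t : EuclideanSpace ℝ (Fin N)}
    (ht : t ∈ cube N 0 1) (j : Fin N) :
    |t j - gridPoint h n (gridIndex h n t) j| ≤ 2 ^ (-((n : ℝ) / h j)) := by
  obtain ⟨h1, h2⟩ := gridPoint_gridIndex_le (h := h) n ht j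
  rw [abs_of_nonneg (by linarith)]
  linarith [inv_two_pow_gridOrder_le (h := h) n j]

lemma abs_sub_le_of_gridIndex_eq (n : ℕ) {s t : EuclideanSpace ℝ (Fin N)}
    (hs : s ∈ cube N 0 1) (ht : t ∈ cube N 0 1) (hst : gridIndex h n s = gridIndex h n t)
    (j : Fin N) : |s j - t j| ≤ 2 ^ (-((n : ℝ) / h j)) := by
  obtain ⟨h1, h2⟩ := gridPoint_gridIndex_le (h := h) n ht j
  obtain ⟨h3, h4⟩ := gridPoint_gridIndex_le (h := h) n hs j
  rw [hst] at h3 h4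
  rw [abs_le]
  have := inv_two_pow_gridOrder_le (h := h) n j
  constructor <;> linarith

lemma gridOrder_mono (hh : ∀ j, 0 < h j) (n : ℕ) (j : Fin N) :
    gridOrder h n j ≤ gridOrder h (n + 1) j := by
  refine Nat.ceil_mono ?_
  have := hh j
  gcongr
  simp

/-- The dyadic grids are nested, so the corner of a box of generation `n + 1` determines its parent.
A chaining link is thus indexed by a box of generation `n + 1` alone, which keeps the union bound
small. -/
lemma gridIndex_gridPoint (hh : ∀ j, 0 < h j) (n : ℕ) (t : EuclideanSpace ℝ (Fin N)) :
    gridIndex h n (gridPoint h (n + 1) (gridIndex h (n + 1) t)) = gridIndex h n t := by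
  funext j
  simp only [gridIndex, gridPoint]
  obtain ⟨k, hk⟩ := Nat.exists_eq_add_of_le (gridOrder_mono hh n j)
  rw [hk]
  have e1 : ∀ a : ℝ, a / 2 ^ (gridOrder h n j + k) * 2 ^ gridOrder h n j =
      a / ((2 ^ k : ℕ) : ℝ) := by
    intro a
    rw [pow_add]
    push_cast
    field_simp
  have e2 : t j * 2 ^ gridOrder h n j =
      (t j * 2 ^ (gridOrder h n j + k)) / ((2 ^ k : ℕ) : ℝ) := by
    rw [pow_add]
    push_cast
    field_simp
  rw [e1, e2, Nat.floor_div_natCast, Nat.floor_div_natCast, Nat.floor_natCast]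

/-- In each direction, rounding the order up costs a factor `2` and the index of the endpoint `t j =
1` costs one more; `4` covers both. -/
lemma card_gridIndices_le (hh : ∀ j, 0 < h j) (n : ℕ) :
    ((gridIndices h n).card : ℝ) ≤ 4 ^ N * ((2 : ℝ) ^ (∑ j, 1 / h j)) ^ n := by
  have h1 : ((2 : ℝ) ^ (∑ j, 1 / h j)) ^ n = ∏ j, (2 : ℝ) ^ ((n : ℝ) / h j) := by
    rw [← Real.rpow_natCast, ← Real.rpow_mul zero_le_two, Finset.sum_mul,
      Real.rpow_sum_of_pos two_pos]
    exact Finset.prod_congr rfl fun j _ => by congr 1; ring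
  have h2 : (4 : ℝ) ^ N = ∏ _j : Fin N, 4 := by simp
  rw [gridIndices, Fintype.card_piFinset, h1, h2, ← Finset.prod_mul_distrib]
  push_cast
  refine Finset.prod_le_prod (fun j _ => by positivity) fun j _ => ?_
  rw [Finset.card_range]
  push_cast
  have h3 : (gridOrder h n j : ℝ) ≤ (n : ℝ) / h j + 1 := by
    have := hh j
    exact (Nat.ceil_lt_add_one (by positivity)).le
  have h4 : (2 : ℝ) ^ gridOrder h n j ≤ 2 ^ ((n : ℝ) / h j) * 2 := by
    rw [← Real.rpow_natCast]
    calc _ ≤ (2 : ℝ) ^ ((n : ℝ) / h j + 1) := Real.rpow_le_rpow_of_exponent_le one_le_two h3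
      _ = _ := by rw [Real.rpow_add two_pos, Real.rpow_one]
  have h5 : (1 : ℝ) ≤ 2 ^ ((n : ℝ) / h j) :=
    Real.one_le_rpow one_le_two (div_nonneg (Nat.cast_nonneg n) (hh j).le)
  linarith

lemma tendsto_gridPoint (hh : ∀ j, 0 < h j) (hh1 : ∀ j, h j ≤ 1) {t : EuclideanSpace ℝ (Fin N)}
    (ht : t ∈ cube N 0 1) :
    Tendsto (fun n => gridPoint h n (gridIndex h n t)) atTop (𝓝 t) := by
  rw [tendsto_iff_dist_tendsto_zero]
  have hlim : Tendsto (fun n : ℕ => √N * (1 / 2 : ℝ) ^ n) atTop (𝓝 (√N * 0)) :=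
    (tendsto_pow_atTop_nhds_zero_of_lt_one (by norm_num) (by norm_num)).const_mul _
  rw [mul_zero] at hlim
  refine squeeze_zero (fun _ => dist_nonneg) (fun n => ?_) hlim
  rw [dist_comm]
  refine dist_le_sqrt_mul (by positivity) fun j => ?_
  refine (abs_sub_gridPoint_le (h := h) n ht j).trans ?_
  rw [one_div, inv_pow, Real.rpow_neg zero_le_two, ← Real.rpow_natCast]
  refine inv_anti₀ (by positivity) (Real.rpow_le_rpow_of_exponent_le one_le_two ?_)
  exact le_div_self (Nat.cast_nonneg n) (hh j) (hh1 j)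

end Grid

/-! ### Oscillation of the field over the grid boxes. -/

section Chaining

open Filter Topology

variable {N p : ℕ} {Ω₀ Ω : Type*} [MeasurableSpace Ω₀] [MeasurableSpace Ω]
  {P₀ : Measure Ω₀} {P : Measure Ω} {X : EuclideanSpace ℝ (Fin N) → Ω₀ → ℝ}
  {Y : Fin p → EuclideanSpace ℝ (Fin N) → Ω → ℝ} {H h : Fin N → ℝ}

/-- Because `h j ≤ H j`, each coordinate contributes at most `2 ^ (-2 * n)` to the scale. The bound
holds only eventually because (D1) is local; `h j ≤ 1` forces the boxes to shrink. -/
lemma integral_sq_increment_gridPoint_le (hH : ∀ j, 0 < H j) (hh : ∀ j, 0 < h j)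
    (hhH : ∀ j, h j ≤ H j) (hh1 : ∀ j, h j ≤ 1) (hD1 : ConditionD1 H X P₀) :
    ∃ K : ℝ, 0 ≤ K ∧ ∀ᶠ n : ℕ in atTop, ∀ t ∈ cube N 0 1,
      ∫ ω, (X t ω - X (gridPoint h n (gridIndex h n t)) ω) ^ 2 ∂P₀ ≤ (K * (1 / 2) ^ n) ^ 2 := by
  obtain ⟨δ, c, hδ, hc, hD⟩ := hD1
  refine ⟨√(c * N), by positivity, ?_⟩
  have hlim : Tendsto (fun n : ℕ => √N * (1 / 2 : ℝ) ^ n) atTop (𝓝 (√N * 0)) :=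
    (tendsto_pow_atTop_nhds_zero_of_lt_one (by norm_num) (by norm_num)).const_mul _
  rw [mul_zero] at hlim
  filter_upwards [hlim.eventually_le_const hδ] with n hn t ht
  have hcoord := abs_sub_gridPoint_le (h := h) n ht
  have hpow : ∀ j, (2 : ℝ) ^ (-((n : ℝ) / h j)) ≤ (1 / 2) ^ n := fun j => by
    rw [one_div, inv_pow, Real.rpow_neg zero_le_two, ← Real.rpow_natCast]
    refine inv_anti₀ (by positivity) (Real.rpow_le_rpow_of_exponent_le one_le_two ?_)
    exact le_div_self (Nat.cast_nonneg n) (hh j) (hh1 j)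
  have hdist : ‖gridPoint h n (gridIndex h n t) - t‖ ≤ δ := by
    rw [← dist_eq_norm, dist_comm]
    exact (dist_le_sqrt_mul (by positivity) fun j => (hcoord j).trans (hpow j)).trans hn
  refine ((hD _ (gridPoint_mem (gridIndex_mem ht)) t ht hdist).2).trans ?_
  rw [mul_pow, Real.sq_sqrt (by positivity), mul_assoc]
  refine mul_le_mul_of_nonneg_left ?_ (by linarith)
  calc anisoScale H (gridPoint h n (gridIndex h n t)) t ≤ ∑ _j : Fin N, ((1 / 2 : ℝ) ^ n) ^ 2 := by
        refine Finset.sum_le_sum fun j _ => ?_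
        rw [abs_sub_comm]
        have hHj := hH j
        calc |t j - gridPoint h n (gridIndex h n t) j| ^ (2 * H j)
            ≤ ((2 : ℝ) ^ (-((n : ℝ) / h j))) ^ (2 * H j) :=
              Real.rpow_le_rpow (abs_nonneg _) (hcoord j) (by linarith)
          _ = 2 ^ (-((n : ℝ) / h j * (2 * H j))) := by
              rw [← Real.rpow_mul zero_le_two]; congr 1; ring
          _ ≤ 2 ^ (-((n * 2 : ℕ) : ℝ)) := by
              refine Real.rpow_le_rpow_of_exponent_le one_le_two (neg_le_neg ?_)
              have h1 : 1 ≤ H j / h j := (one_le_div (hh j)).2 (hhH j)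
              have h2 : (n : ℝ) / h j * (2 * H j) = (n * 2) * (H j / h j) := by ring
              rw [h2]
              push_cast
              exact le_mul_of_one_le_right (by positivity) h1
          _ = _ := by
              rw [Real.rpow_neg zero_le_two, Real.rpow_natCast, ← pow_mul, one_div, inv_pow]
    _ = _ := by simp

/-- Almost surely, the oscillation of the field over the `n`-th generation boxes is eventually
of order at most `ρ ^ n`, for any `ρ > 1 / 2`. -/
lemma ae_eventually_abs_sub_gridPoint_le (hH : ∀ j, 0 < H j) (hh : ∀ j, 0 < h j)
    (hhH : ∀ j, h j ≤ H j) (hh1 : ∀ j, h j ≤ 1) (hX : IsCenteredGaussianField X P₀)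
    (hD1 : ConditionD1 H X P₀) (hY : AreIndependentCopies Y P X P₀)
    (hcont : ∀ᵐ ω ∂P, ContinuousOn (fun t => vectorField Y t ω) (cube N 0 1))
    {ρ : ℝ} (hρ : 1 / 2 < ρ) (hρ1 : ρ < 1) :
    ∀ᵐ ω ∂P, ∀ᶠ n : ℕ in atTop, ∀ t ∈ cube N 0 1, ∀ k,
      |Y k (gridPoint h n (gridIndex h n t)) ω - Y k t ω| ≤ ρ ^ n / (1 - ρ) := by
  have hρ0 : 0 < ρ := by linarith
  obtain ⟨K, hK, hKev⟩ := integral_sq_increment_gridPoint_le hH hh hhH hh1 hD1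
  set B : ℝ := 2 ^ (∑ j, 1 / h j) with hB
  have hB0 : 0 < B := by positivity
  -- There are of order `B ^ n` links, and each exceeds `ρ ^ n` with probability of order `(1 / (2 *
  -- ρ)) ^ (q * n)`; this `q` makes the product summable for Borel–Cantelli.
  obtain ⟨q, hq⟩ : ∃ q : ℕ, B * (1 / (2 * ρ)) ^ q < 1 := by
    have h1 : 1 / (2 * ρ) < 1 := by rw [div_lt_one (by linarith)]; linarith
    obtain ⟨q, hq⟩ := exists_pow_lt_of_lt_one (inv_pos.2 hB0) h1
    exact ⟨q, by rw [← lt_inv_mul_iff₀ hB0]; simpa using hq⟩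
  obtain ⟨M, hM, hMle⟩ := measure_increment_le hX hY q
  set u : ℕ → (Fin N → ℕ) → EuclideanSpace ℝ (Fin N) := fun n i => gridPoint h (n + 1) i with hu
  set v : ℕ → (Fin N → ℕ) → EuclideanSpace ℝ (Fin N) :=
    fun n i => gridPoint h n (gridIndex h n (u n i)) with hv
  set bad : ℕ → Set Ω := fun n =>
    ⋃ i ∈ gridIndices h (n + 1), {ω | ∃ k, ρ ^ n ≤ |Y k (u n i) ω - Y k (v n i) ω|} with hbad
  set η : ℝ := B * (1 / (2 * ρ)) ^ q with hη
  have hη0 : 0 ≤ η := by positivity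
  have hbadP : ∀ᶠ n in atTop, P (bad n) ≤
      M * ENNReal.ofReal (4 ^ N * B * K ^ q) * ENNReal.ofReal (η ^ n) := by
    filter_upwards [hKev] with n hn
    calc P (bad n) ≤ ∑ i ∈ gridIndices h (n + 1),
          P {ω | ∃ k, ρ ^ n ≤ |Y k (u n i) ω - Y k (v n i) ω|} := measure_biUnion_finset_le _ _
      _ ≤ ∑ _i ∈ gridIndices h (n + 1), M * ENNReal.ofReal ((K * (1 / 2) ^ n / ρ ^ n) ^ q) :=
          Finset.sum_le_sum fun i hi => hMle _ _ _ _ (by positivity) (by positivity)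
            (hn _ (gridPoint_mem hi))
      _ = M * (ENNReal.ofReal ((gridIndices h (n + 1)).card) *
            ENNReal.ofReal ((K * (1 / 2) ^ n / ρ ^ n) ^ q)) := by
          rw [Finset.sum_const, nsmul_eq_mul, ENNReal.ofReal_natCast]; ring
      _ ≤ M * (ENNReal.ofReal (4 ^ N * B ^ (n + 1)) *
            ENNReal.ofReal ((K * (1 / 2) ^ n / ρ ^ n) ^ q)) := by
          gcongr
          exact card_gridIndices_le hh (n + 1)
      _ = _ := by
          rw [mul_assoc, ← ENNReal.ofReal_mul (by positivity), ← ENNReal.ofReal_mul (by positivity)]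
          congr 2
          rw [hη, mul_pow, ← pow_mul, mul_comm q n, pow_mul, pow_succ]
          have : K * (1 / 2) ^ n / ρ ^ n = K * (1 / (2 * ρ)) ^ n := by
            rw [mul_div_assoc, ← div_pow]; congr 2; field_simp
          rw [this, mul_pow]
          ring
  have hae : ∀ᵐ ω ∂P, ∀ᶠ n in atTop, ω ∉ bad n := by
    obtain ⟨n₀, hn₀⟩ := eventually_atTop.1 hbadP
    have h1 : ∑' n, P (bad (n + n₀)) ≠ ⊤ := by
      refine ne_top_of_le_ne_top ?_ (ENNReal.tsum_le_tsum fun n => hn₀ (n + n₀) (by omega))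
      rw [ENNReal.tsum_mul_left]
      refine ENNReal.mul_ne_top (by finiteness) ?_
      have hs : Summable fun n : ℕ => η ^ (n + n₀) :=
        (summable_nat_add_iff n₀).2 (summable_geometric_of_lt_one hη0 hq)
      rw [← ENNReal.ofReal_tsum_of_nonneg (fun n => by positivity) hs]
      exact ENNReal.ofReal_ne_top
    filter_upwards [ae_eventually_notMem h1] with ω hω
    obtain ⟨m, hm⟩ := eventually_atTop.1 hω
    refine eventually_atTop.2 ⟨m + n₀, fun n hn => ?_⟩
    have := hm (n - n₀) (by omega)
    rwa [Nat.sub_add_cancel (by omega)] at this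
  filter_upwards [hae, hcont] with ω hω hc
  obtain ⟨n₀, hn₀⟩ := eventually_atTop.1 hω
  refine eventually_atTop.2 ⟨n₀, fun n hn t ht k => ?_⟩
  -- The values at the corners of the successive boxes around `t` move by geometrically decaying
  -- steps and converge to the value at `t` by continuity.
  set f : ℕ → ℝ := fun l => Y k (gridPoint h (n + l) (gridIndex h (n + l) t)) ω with hf
  have hstep : ∀ l, dist (f l) (f (l + 1)) ≤ ρ ^ n * ρ ^ l := by
    intro l
    have h1 := hn₀ (n + l) (by omega)
    simp only [hbad, Set.mem_iUnion, not_exists, Set.mem_ofPred_eq, not_le] at h1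
    have h2 := h1 (gridIndex h (n + l + 1) t) (gridIndex_mem ht) k
    simp only [hu, hv] at h2
    rw [gridIndex_gridPoint hh] at h2
    rw [dist_comm, Real.dist_eq, ← pow_add]
    exact h2.le
  have hlim : Tendsto f atTop (𝓝 (Y k t ω)) := by
    have hck : ContinuousOn (fun t => Y k t ω) (cube N 0 1) :=
      (EuclideanSpace.proj (𝕜 := ℝ) k).continuous.comp_continuousOn hc
    have h1 : Tendsto (fun l => gridPoint h l (gridIndex h l t)) atTop (𝓝[cube N 0 1] t) :=
      tendsto_nhdsWithin_iff.2 ⟨tendsto_gridPoint hh hh1 ht,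
        Eventually.of_forall fun l => gridPoint_mem (gridIndex_mem ht)⟩
    have h2 := (hck t ht).tendsto.comp h1
    have h3 := h2.comp (tendsto_add_atTop_nat n)
    refine h3.congr fun l => ?_
    simp [hf, add_comm]
  have := dist_le_of_le_geometric_of_tendsto₀ ρ (ρ ^ n) hρ1 hstep hlim
  simpa [Real.dist_eq, hf] using this

end Chaining

/-! ### Upper bound for the dimension of level sets -/

/-- The small-ball bound needs a positive lower bound on the variance, so the non-degenerate points
are exhausted by countably many pieces. -/
lemma levelSet_subset {N p : ℕ} {Ω₀ Ω : Type*} [MeasurableSpace Ω₀] {P₀ : Measure Ω₀}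
    {X : EuclideanSpace ℝ (Fin N) → Ω₀ → ℝ} {Y : Fin p → EuclideanSpace ℝ (Fin N) → Ω → ℝ}
    (x : EuclideanSpace ℝ (Fin p)) (ω : Ω) :
    levelSet Y x ω ⊆ (⋃ m : ℕ, {t | t ∈ levelSet Y x ω ∧ 1 / ((m : ℝ) + 1) ≤ Var[X t; P₀]}) ∪
      {t | t ∈ cube N 0 1 ∧ Var[X t; P₀] = 0} := by
  intro t ht
  rcases (variance_nonneg (X t) P₀).eq_or_lt with h0 | h0
  · exact Or.inr ⟨ht.1, h0.symm⟩
  · obtain ⟨m, hm⟩ := exists_nat_one_div_lt h0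
    exact Or.inl (Set.mem_iUnion.2 ⟨m, ht, hm.le⟩)

section UpperBound

open Filter Topology

variable {N p : ℕ} {Ω₀ Ω : Type*} [MeasurableSpace Ω₀] [MeasurableSpace Ω]
  {P₀ : Measure Ω₀} {P : Measure Ω} {X : EuclideanSpace ℝ (Fin N) → Ω₀ → ℝ}
  {Y : Fin p → EuclideanSpace ℝ (Fin N) → Ω → ℝ} {H h : Fin N → ℝ}

/-- Almost surely, the non-degenerate part of a level set is eventually covered by `S n` boxes of
generation `n`, where `β ^ n * #(S n)` tends to zero. -/
lemma ae_exists_grid_cover (hH : ∀ j, 0 < H j) (hh : ∀ j, 0 < h j)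
    (hhH : ∀ j, h j ≤ H j) (hh1 : ∀ j, h j ≤ 1) (hX : IsCenteredGaussianField X P₀)
    (hD1 : ConditionD1 H X P₀) (hY : AreIndependentCopies Y P X P₀)
    (hcont : ∀ᵐ ω ∂P, ContinuousOn (fun t => vectorField Y t ω) (cube N 0 1))
    (x : EuclideanSpace ℝ (Fin p)) {v : ℝ} (hv : 0 < v) {β : ℝ} (hβ : 0 < β)
    (hβp : β * 2 ^ (∑ j, 1 / h j) * (1 / 2) ^ p < 1) :
    ∀ᵐ ω ∂P, ∃ S : ℕ → Finset (Fin N → ℕ),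
      (∀ᶠ n in atTop, ∀ t ∈ levelSet Y x ω, v ≤ Var[X t; P₀] → gridIndex h n t ∈ S n) ∧
      Tendsto (fun n => β ^ n * ((S n).card : ℝ)) atTop (𝓝 0) := by
  classical
  set B : ℝ := 2 ^ (∑ j, 1 / h j) with hB
  have hB0 : 0 < B := by positivity
  -- The hypothesis is strict at `ρ = 1 / 2`, so by continuity it persists for some slightly larger
  -- `ρ`, as the oscillation estimate requires.
  obtain ⟨ρ, hρ, hρ1, hρp⟩ : ∃ ρ : ℝ, 1 / 2 < ρ ∧ ρ < 1 ∧ β * B * ρ ^ p < 1 := by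
    have hc : Tendsto (fun ρ : ℝ => β * B * ρ ^ p) (𝓝[>] (1 / 2)) (𝓝 (β * B * (1 / 2) ^ p)) :=
      ((continuous_const.mul (continuous_pow p)).tendsto _).mono_left nhdsWithin_le_nhds
    have h1 := hc.eventually_lt_const hβp
    have h2 : ∀ᶠ ρ : ℝ in 𝓝[>] (1 / 2), ρ ∈ Set.Ioo (1 / 2 : ℝ) 1 :=
      Ioo_mem_nhdsGT (by norm_num)
    obtain ⟨ρ, h3, h4⟩ := (h1.and h2).exists
    exact ⟨ρ, h4.1, h4.2, h3⟩
  have hρ0 : 0 < ρ := by linarith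
  have hosc := ae_eventually_abs_sub_gridPoint_le hH hh hhH hh1 hX hD1 hY hcont hρ hρ1
  -- Twice the oscillation constant: a point of the level set is compared with the reference point
  -- through the box corner. The corner itself cannot serve as reference point, since its variance
  -- may be below `v`.
  set C : ℝ := 2 / (1 - ρ) with hC
  have hC0 : 0 < C := by rw [hC]; apply div_pos <;> linarith
  -- a reference point in each box meeting the non-degenerate part of the cube
  set occ : ℕ → (Fin N → ℕ) → EuclideanSpace ℝ (Fin N) → Prop := fun n i t =>
    t ∈ cube N 0 1 ∧ v ≤ Var[X t; P₀] ∧ gridIndex h n t = i with hocc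
  set pt : ℕ → (Fin N → ℕ) → EuclideanSpace ℝ (Fin N) := fun n i =>
    if hi : ∃ t, occ n i t then hi.choose else 0 with hpt
  have hpt' : ∀ n i, (∃ t, occ n i t) → occ n i (pt n i) := fun n i hi => by
    simp only [hpt, hi, dite_true]
    exact hi.choose_spec
  set hit : ℕ → (Fin N → ℕ) → Set Ω := fun n i =>
    {ω | (∃ t, occ n i t) ∧ ∀ k, |Y k (pt n i) ω - x k| ≤ C * ρ ^ n} with hhit
  have hhitm : ∀ n i, MeasurableSet (hit n i) := fun n i => by
    by_cases hi : ∃ t, occ n i t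
    · have : hit n i = ⋂ k, {ω | |Y k (pt n i) ω - x k| ≤ C * ρ ^ n} := by
        ext ω; simp [hhit, hi]
      rw [this]
      exact MeasurableSet.iInter fun k => measurableSet_le
        (((hY.measurable k _).sub measurable_const).norm) measurable_const
    · have : hit n i = ∅ := by ext ω; simp [hhit, hi]
      rw [this]
      exact MeasurableSet.empty
  set A : ENNReal := ENNReal.ofReal ((2 * C / √v) ^ p) with hA
  have hhitP : ∀ n i, P (hit n i) ≤ A * ENNReal.ofReal ((ρ ^ p) ^ n) := fun n i => by
    by_cases hi : ∃ t, occ n i t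
    · refine (measure_mono fun ω hω => hω.2).trans ((measure_near_le hX hY hv (hpt' n i hi).2.1 x
        (by positivity : 0 ≤ C * ρ ^ n)).trans (le_of_eq ?_))
      rw [hA, ← ENNReal.ofReal_pow (by positivity), ← ENNReal.ofReal_mul (by positivity)]
      congr 1
      rw [← pow_mul, mul_comm p n, pow_mul, ← mul_pow]
      congr 1
      ring
    · have : hit n i = ∅ := by ext ω; simp [hhit, hi]
      rw [this]
      simp
  clear_value A
  set S : Ω → ℕ → Finset (Fin N → ℕ) := fun ω n =>
    (gridIndices h n).filter fun i => ω ∈ hit n i with hS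
  have hScard : ∀ ω n, ((S ω n).card : ENNReal) =
      ∑ i ∈ gridIndices h n, (hit n i).indicator (fun _ => 1) ω := fun ω n => by
    simp only [hS, Finset.card_filter, Set.indicator_apply]
    push_cast
    rfl
  set f : ℕ → Ω → ENNReal := fun n ω => ENNReal.ofReal (β ^ n) * (S ω n).card with hf
  have hfm : ∀ n, Measurable (f n) := fun n => by
    simp only [hf, hScard]
    exact (Finset.measurable_fun_sum _ fun i _ =>
      measurable_const.indicator (hhitm n i)).const_mul _
  have hfint : ∀ n, ∫⁻ ω, f n ω ∂P ≤
      A * ENNReal.ofReal (4 ^ N) * ENNReal.ofReal ((β * B * ρ ^ p) ^ n) := fun n => by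
    have h1 : ∫⁻ ω, f n ω ∂P =
        ENNReal.ofReal (β ^ n) * ∑ i ∈ gridIndices h n, P (hit n i) := by
      simp only [hf, hScard]
      rw [lintegral_const_mul _ (Finset.measurable_fun_sum _ fun i _ =>
        measurable_const.indicator (hhitm n i)), lintegral_finsetSum _ fun i _ =>
        measurable_const.indicator (hhitm n i)]
      congr 1
      refine Finset.sum_congr rfl fun i _ => ?_
      rw [lintegral_indicator_const (hhitm n i), one_mul]
    rw [h1]
    calc _ ≤ ENNReal.ofReal (β ^ n) *
          ∑ _i ∈ gridIndices h n, A * ENNReal.ofReal ((ρ ^ p) ^ n) := by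
          gcongr with i hi
          exact hhitP n i
      _ = A * (ENNReal.ofReal (β ^ n) * ENNReal.ofReal ((gridIndices h n).card) *
          ENNReal.ofReal ((ρ ^ p) ^ n)) := by
          rw [Finset.sum_const, nsmul_eq_mul, ENNReal.ofReal_natCast]; ring
      _ ≤ A * (ENNReal.ofReal (β ^ n) * ENNReal.ofReal (4 ^ N * B ^ n) *
          ENNReal.ofReal ((ρ ^ p) ^ n)) := by
          gcongr
          exact card_gridIndices_le hh n
      _ = _ := by
          rw [mul_assoc A, ← ENNReal.ofReal_mul (by positivity),
            ← ENNReal.ofReal_mul (by positivity), ← ENNReal.ofReal_mul (by positivity)]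
          congr 2
          rw [mul_pow, mul_pow]
          ring
  -- The expectations are summable, so almost surely the series `∑ f n` converges and its terms tend
  -- to zero.
  have hfsum : ∫⁻ ω, ∑' n, f n ω ∂P ≠ ⊤ := by
    rw [lintegral_tsum fun n => (hfm n).aemeasurable]
    refine ne_top_of_le_ne_top ?_ (ENNReal.tsum_le_tsum hfint)
    rw [ENNReal.tsum_mul_left,
      ← ENNReal.ofReal_tsum_of_nonneg (fun n => by positivity)
        (summable_geometric_of_lt_one (by positivity) hρp), hA]
    finiteness
  filter_upwards [hosc, ae_lt_top (Measurable.tsum hfm) hfsum] with ω hω1 hω2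
  refine ⟨S ω, ?_, ?_⟩
  · filter_upwards [hω1] with n hn t ht htv
    have hoccn : occ n (gridIndex h n t) t := ⟨ht.1, htv, rfl⟩
    obtain ⟨hp1, hp2, hp3⟩ := hpt' n _ ⟨t, hoccn⟩
    simp only [hS, Finset.mem_filter]
    refine ⟨gridIndex_mem ht.1, ⟨t, hoccn⟩, fun k => ?_⟩
    have h1 := hn t ht.1 k
    have h2 := hn _ hp1 k
    rw [hp3] at h2
    have h3 : Y k t ω = x k := by
      have := congrArg (fun z : EuclideanSpace ℝ (Fin p) => z k) ht.2
      simpa [vectorField] using this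
    have h4 : C * ρ ^ n = ρ ^ n / (1 - ρ) + ρ ^ n / (1 - ρ) := by rw [hC]; ring
    rw [← h3, h4]
    rw [abs_sub_comm] at h2
    calc _ ≤ _ := abs_sub_le _ (Y k (gridPoint h n (gridIndex h n t)) ω) _
      _ ≤ _ := add_le_add h2 h1
  · have h1 := ENNReal.tendsto_atTop_zero_of_tsum_ne_top hω2.ne
    have h2 := (ENNReal.tendsto_toReal ENNReal.zero_ne_top).comp h1
    rw [ENNReal.toReal_zero] at h2
    refine h2.congr fun n => ?_
    simp only [Function.comp_apply, hf]
    rw [ENNReal.toReal_mul, ENNReal.toReal_ofReal (by positivity), ENNReal.toReal_natCast]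

/-- The points of the unit cube where the field degenerates are isolated. -/
lemma countable_variance_eq_zero (hX : IsCenteredGaussianField X P₀) (hD1 : ConditionD1 H X P₀) :
    {t | t ∈ cube N 0 1 ∧ Var[X t; P₀] = 0}.Countable := by
  obtain ⟨δ, c, hδ, hc, hD⟩ := hD1
  obtain ⟨F, -, hFfin, hcov⟩ := (isCompact_cube (N := N) 0 1).finite_cover_balls (half_pos hδ)
  have hsub : {t | t ∈ cube N 0 1 ∧ Var[X t; P₀] = 0} ⊆
      ⋃ z ∈ F, ({t | t ∈ cube N 0 1 ∧ Var[X t; P₀] = 0} ∩ Metric.ball z (δ / 2)) := by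
    intro t ht
    obtain ⟨z, hz, htz⟩ := Set.mem_iUnion₂.1 (hcov ht.1)
    exact Set.mem_iUnion₂.2 ⟨z, hz, ht, htz⟩
  -- Two distinct degenerate points in one ball of radius `δ / 2` would have an almost surely zero
  -- increment, against the lower bound in (D1).
  refine (hFfin.countable.biUnion fun z _ => Set.Subsingleton.countable ?_).mono hsub
  rintro s ⟨⟨hs, hs0⟩, hsz⟩ t ⟨⟨ht, ht0⟩, htz⟩
  by_contra hst
  have hdist : ‖s - t‖ ≤ δ := by
    rw [← dist_eq_norm]
    have := dist_triangle_right s t z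
    have h1 := Metric.mem_ball.1 hsz
    have h2 := Metric.mem_ball.1 htz
    linarith
  have h1 := (hD s hs t ht hdist).1
  have h2 : 0 < c⁻¹ * anisoScale H s t := mul_pos (by positivity) (anisoScale_pos hst)
  rw [hX.variance_eq] at hs0 ht0
  have hae : ∀ u, ∫ ω, X u ω ^ 2 ∂P₀ = 0 → ∀ᵐ ω ∂P₀, X u ω = 0 := fun u hu => by
    have := (integral_eq_zero_iff_of_nonneg (fun ω => sq_nonneg (X u ω))
      (hX.memLp u).integrable_sq).1 hu
    filter_upwards [this] with ω hω
    exact pow_eq_zero_iff two_ne_zero |>.1 hω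
  have h3 : ∫ ω, (X t ω - X s ω) ^ 2 ∂P₀ = 0 := by
    rw [integral_eq_zero_of_ae]
    filter_upwards [hae s hs0, hae t ht0] with ω w1 w2
    simp [w1, w2]
  linarith

/-- With `β = 1` the number of covering boxes is an integer tending to zero, hence eventually zero.
At the countably many degenerate points the field vanishes almost surely, which excludes them
because `x ≠ 0`. -/
theorem ae_levelSet_eq_empty (hH : ∀ j, 0 < H j) (hH1 : ∀ j, H j ≤ 1)
    (hX : IsCenteredGaussianField X P₀)
    (hD1 : ConditionD1 H X P₀) (hY : AreIndependentCopies Y P X P₀)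
    (hcont : ∀ᵐ ω ∂P, ContinuousOn (fun t => vectorField Y t ω) (cube N 0 1))
    (hQ : ∑ j, 1 / H j < (p : ℝ)) {x : EuclideanSpace ℝ (Fin p)} (hx : x ≠ 0) :
    ∀ᵐ ω ∂P, levelSet Y x ω = ∅ := by
  have hlt : (1 : ℝ) * 2 ^ (∑ j, 1 / H j) * (1 / 2) ^ p < 1 := by
    rw [one_mul, one_div 2, inv_pow, ← Real.rpow_natCast, mul_inv_lt_iff₀ (by positivity), one_mul]
    exact Real.rpow_lt_rpow_of_exponent_lt one_lt_two hQ
  have hcover := fun m : ℕ => ae_exists_grid_cover hH hH (fun _ => le_rfl) hH1 hX hD1 hY hcont x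
    (v := 1 / ((m : ℝ) + 1)) (by positivity) one_pos hlt
  have hdeg : ∀ᵐ ω ∂P, ∀ t ∈ {t | t ∈ cube N 0 1 ∧ Var[X t; P₀] = 0}, ∀ i, Y i t ω = 0 := by
    rw [ae_ball_iff (countable_variance_eq_zero hX hD1)]
    intro t ht
    rw [ae_all_iff]
    intro i
    have hS : MeasurableSet {f : EuclideanSpace ℝ (Fin N) → ℝ | f t ∈ ({0}ᶜ : Set ℝ)} :=
      measurable_pi_apply t (measurableSet_singleton 0).compl
    have h1 := hY.measure_path i hS
    have h2 := hX.measure_preimage t (S := {0}ᶜ) (measurableSet_singleton 0).compl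
    rw [ht.2] at h2
    rw [ae_iff]
    refine h1.trans (h2.trans ?_)
    simp
  filter_upwards [ae_all_iff.2 hcover, hdeg] with ω hω1 hω2
  refine Set.eq_empty_of_forall_notMem fun t ht => ?_
  rcases levelSet_subset (P₀ := P₀) (X := X) x ω ht with h1 | h1
  · obtain ⟨m, -, hm⟩ := Set.mem_iUnion.1 h1
    obtain ⟨S, hS, hlim⟩ := hω1 m
    simp only [one_pow, one_mul] at hlim
    obtain ⟨n, hn1, hn2⟩ := (hS.and (hlim.eventually_lt_const one_pos)).exists
    have h2 : (S n).card = 0 := by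
      have : (S n).card < 1 := by exact_mod_cast hn2
      omega
    have h3 := hn1 t ht hm
    rw [Finset.card_eq_zero.1 h2] at h3
    simp at h3
  · refine hx ?_
    rw [← ht.2]
    refine PiLp.ext fun i => ?_
    simpa [vectorField] using hω2 t h1 i

/-- Almost surely the level set has dimension at most `levelDim H p`. -/
theorem ae_dimH_levelSet_le [NeZero N] (hH : ∀ j, 0 < H j) (hH1 : ∀ j, H j ≤ 1)
    (hmono : Monotone H) (hX : IsCenteredGaussianField X P₀)
    (hD1 : ConditionD1 H X P₀) (hY : AreIndependentCopies Y P X P₀)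
    (hcont : ∀ᵐ ω ∂P, ContinuousOn (fun t => vectorField Y t ω) (cube N 0 1))
    (hQ : (p : ℝ) < ∑ j, 1 / H j) (x : EuclideanSpace ℝ (Fin p)) :
    ∀ᵐ ω ∂P, dimH (levelSet Y x ω) ≤ ENNReal.ofReal (levelDim H p) := by
  have hL := levelDim_pos hH hmono hQ
  obtain ⟨k, -, hk⟩ := Finset.exists_mem_eq_inf' (s := Finset.univ) Finset.univ_nonempty
    fun k : Fin N => (∑ j ∈ Finset.Iic k, H k / H j) + ((N : ℝ) - ((k : ℕ) + 1 : ℝ))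
      - H k * (p : ℝ)
  change levelDim H p = _ at hk
  -- Truncation at `H k` subdivides the directions `j > k`, so that no side exceeds `2 ^ (-n / H
  -- k)`; the directions `j ≤ k` keep their own scale.
  set h : Fin N → ℝ := fun j => min (H j) (H k) with hh
  have hh0 : ∀ j, 0 < h j := fun j => lt_min (hH j) (hH k)
  have hexp : H k * (∑ j, 1 / h j - p) = levelDim H p := by
    have hsplit : ∑ j, 1 / h j = ∑ j ∈ Finset.Iic k, 1 / h j + ∑ j ∈ Finset.Ioi k, 1 / h j := by
      rw [← Finset.sum_union]
      · congr 1
        ext j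
        simpa using le_or_gt j k
      · rw [Finset.disjoint_left]
        intro j hj hj'
        exact absurd (Finset.mem_Iic.1 hj) (not_le.2 (Finset.mem_Ioi.1 hj'))
    have e1 : ∑ j ∈ Finset.Iic k, 1 / h j = ∑ j ∈ Finset.Iic k, 1 / H j :=
      Finset.sum_congr rfl fun j hj => by
        simp only [hh]; rw [min_eq_left (hmono (Finset.mem_Iic.1 hj))]
    have e2 : ∑ j ∈ Finset.Ioi k, 1 / h j = ((N : ℝ) - ((k : ℕ) + 1)) * (1 / H k) := by
      have : ∑ j ∈ Finset.Ioi k, 1 / h j = ∑ _j ∈ Finset.Ioi k, 1 / H k :=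
        Finset.sum_congr rfl fun j hj => by
          simp only [hh]; rw [min_eq_right (hmono (Finset.mem_Ioi.1 hj).le)]
      have hkN : ((N - 1 - (k : ℕ) : ℕ) : ℝ) = (N : ℝ) - ((k : ℕ) + 1) := by
        have := k.2
        rw [Nat.sub_sub, Nat.cast_sub (by omega)]
        push_cast
        ring
      rw [this, Finset.sum_const, Fin.card_Ioi, nsmul_eq_mul, hkN]
    have e3 : ∑ j ∈ Finset.Iic k, H k / H j = H k * ∑ j ∈ Finset.Iic k, 1 / H j := by
      rw [Finset.mul_sum]
      exact Finset.sum_congr rfl fun j _ => by ring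
    have := (hH k).ne'
    rw [hk, hsplit, e1, e2, e3]
    field_simp
  have hmain : ∀ g : ℝ, levelDim H p < g → ∀ᵐ ω ∂P,
      dimH (levelSet Y x ω) ≤ ENNReal.ofReal g := by
    intro g hg
    have hg0 : 0 < g := hL.trans hg
    -- Up to the factor `√N ^ g`, `β ^ n` is the `g`-th power of the diameter bound for the boxes of
    -- generation `n`.
    set β : ℝ := 2 ^ (-(g / H k)) with hβ
    have hlt : β * 2 ^ (∑ j, 1 / h j) * (1 / 2) ^ p < 1 := by
      have e1 : ((1 : ℝ) / 2) ^ p = 2 ^ (-(p : ℝ)) := by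
        rw [Real.rpow_neg zero_le_two, Real.rpow_natCast, one_div, inv_pow]
      rw [hβ, e1, ← Real.rpow_add two_pos, ← Real.rpow_add two_pos]
      refine Real.rpow_lt_one_of_one_lt_of_neg one_lt_two ?_
      have : ∑ j, 1 / h j - p < g / H k := by
        rw [lt_div_iff₀ (hH k), mul_comm, hexp]; exact hg
      linarith
    have hcover := fun m : ℕ => ae_exists_grid_cover hH hh0 (fun j => min_le_left _ _)
      (fun j => (min_le_left _ _).trans (hH1 j)) hX hD1 hY hcont x
      (v := 1 / ((m : ℝ) + 1)) (by positivity) (by positivity : 0 < β) hlt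
    filter_upwards [ae_all_iff.2 hcover] with ω hω
    refine (dimH_mono (levelSet_subset (P₀ := P₀) (X := X) x ω)).trans ?_
    rw [dimH_union, dimH_countable (countable_variance_eq_zero hX hD1), max_eq_left zero_le,
      dimH_iUnion]
    refine iSup_le fun m => ?_
    obtain ⟨S, hS, hSlim⟩ := hω m
    refine dimH_le_of_hausdorffMeasure_ne_top (d := g.toNNReal) ?_
    rw [Real.coe_toNNReal _ hg0.le]
    set e : ℕ → ℝ := fun n => √N * 2 ^ (-((n : ℝ) / H k)) with he
    have he0 : ∀ n, 0 ≤ e n := fun n => by positivity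
    have hepow : ∀ n, e n ^ g = √N ^ g * β ^ n := fun n => by
      rw [he, hβ]
      simp only
      rw [Real.mul_rpow (by positivity) (by positivity), ← Real.rpow_mul zero_le_two,
        ← Real.rpow_natCast, ← Real.rpow_mul zero_le_two]
      congr 2
      ring
    have helim : Tendsto e atTop (𝓝 0) := by
      have h1 : Tendsto (fun n : ℕ => √N * ((2 : ℝ) ^ (-(1 / H k))) ^ n) atTop (𝓝 (√N * 0)) := by
        refine (tendsto_pow_atTop_nhds_zero_of_lt_one (by positivity) ?_).const_mul _
        exact Real.rpow_lt_one_of_one_lt_of_neg one_lt_two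
          (neg_neg_of_pos (one_div_pos.2 (hH k)))
      rw [mul_zero] at h1
      refine h1.congr fun n => ?_
      simp only [he]
      rw [← Real.rpow_natCast, ← Real.rpow_mul zero_le_two]
      congr 2
      ring
    set box : ∀ n : ℕ, {i // i ∈ S n} → Set (EuclideanSpace ℝ (Fin N)) := fun n i =>
      {t | t ∈ cube N 0 1 ∧ gridIndex h n t = i} with hbox
    have hdiam : ∀ n i, Metric.ediam (box n i) ≤ ENNReal.ofReal (e n) := fun n i => by
      refine Metric.ediam_le fun s hs t ht => ?_
      rw [edist_dist]
      refine ENNReal.ofReal_le_ofReal (dist_le_sqrt_mul (by positivity) fun j => ?_)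
      refine (abs_sub_le_of_gridIndex_eq n hs.1 ht.1 (hs.2.trans ht.2.symm) j).trans ?_
      refine Real.rpow_le_rpow_of_exponent_le one_le_two (neg_le_neg ?_)
      have := hh0 j
      have h2 : h j ≤ H k := min_le_right _ _
      gcongr
    have hlim0 : Tendsto (fun n => ENNReal.ofReal (e n)) atTop (𝓝 0) := by
      simpa using ENNReal.tendsto_ofReal helim
    have hle := Measure.hausdorffMeasure_le_liminf_sum g
      {t | t ∈ levelSet Y x ω ∧ 1 / ((m : ℝ) + 1) ≤ Var[X t; P₀]} _ hlim0 box
      (Eventually.of_forall hdiam) (by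
        filter_upwards [hS] with n hn t ht
        exact Set.mem_iUnion.2 ⟨⟨gridIndex h n t, hn t ht.1 ht.2⟩, ht.1.1, rfl⟩)
    have hsumlim : Tendsto (fun n => ENNReal.ofReal (√N ^ g * (β ^ n * ((S n).card : ℝ)))) atTop
        (𝓝 0) := by
      have := ENNReal.tendsto_ofReal (hSlim.const_mul (√N ^ g))
      simpa using this
    have hsum : ∀ n, ∑ i, Metric.ediam (box n i) ^ g ≤
        ENNReal.ofReal (√N ^ g * (β ^ n * ((S n).card : ℝ))) := fun n => by
      calc _ ≤ ∑ _i : {i // i ∈ S n}, ENNReal.ofReal (e n ^ g) := by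
            refine Finset.sum_le_sum fun i _ => ?_
            rw [← ENNReal.ofReal_rpow_of_nonneg (he0 n) hg0.le]
            exact ENNReal.rpow_le_rpow (hdiam n i) hg0.le
        _ = _ := by
            rw [Finset.sum_const, Finset.card_univ, Fintype.card_coe, nsmul_eq_mul, hepow,
              ← ENNReal.ofReal_natCast, ← ENNReal.ofReal_mul (by positivity)]
            congr 1
            ring
    have hzero : liminf (fun n => ∑ i, Metric.ediam (box n i) ^ g) atTop = 0 :=
      (tendsto_of_tendsto_of_tendsto_of_le_of_le tendsto_const_nhds hsumlim
        (fun n => zero_le) hsum).liminf_eq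
    rw [hzero] at hle
    exact (hle.trans_lt ENNReal.zero_lt_top).ne
  have hall := ae_all_iff.2 fun m : ℕ =>
    hmain (levelDim H p + 1 / ((m : ℝ) + 1)) (by
      have : (0 : ℝ) < 1 / ((m : ℝ) + 1) := by positivity
      linarith)
  filter_upwards [hall] with ω hω
  have hlim : Tendsto (fun m : ℕ => levelDim H p + 1 / ((m : ℝ) + 1)) atTop
      (𝓝 (levelDim H p + 0)) := tendsto_one_div_add_atTop_nhds_zero_nat.const_add _
  rw [add_zero] at hlim
  exact ge_of_tendsto' (ENNReal.tendsto_ofReal hlim) hω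

end UpperBound

/-! ### The main theorem. -/

theorem theorem5p2 {N p : ℕ} [NeZero N] (hp : 1 ≤ p)
    (H : Fin N → ℝ) (hH_pos : ∀ j, 0 < H j) (hH_le : ∀ j, H j ≤ 1) (hH_mono : Monotone H)
    {Ω₀ Ω : Type*} [MeasurableSpace Ω₀] [MeasurableSpace Ω]
    (P₀ : Measure Ω₀) [IsProbabilityMeasure P₀] (P : Measure Ω) [IsProbabilityMeasure P]
    (X : EuclideanSpace ℝ (Fin N) → Ω₀ → ℝ) (hX : IsCenteredGaussianField X P₀)
    (hD1 : ConditionD1 H X P₀) (hD2 : ConditionD2 H X P₀)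
    (Y : Fin p → EuclideanSpace ℝ (Fin N) → Ω → ℝ) (hY : AreIndependentCopies Y P X P₀)
    (hcont : ∀ᵐ ω ∂P, ContinuousOn (fun t => vectorField Y t ω) (cube N 0 1)) :
    ((∑ j, 1 / H j < (p : ℝ)) →
      ∀ x : EuclideanSpace ℝ (Fin p), x ≠ 0 → ∀ᵐ ω ∂P, levelSet Y x ω = ∅) ∧
    (((p : ℝ) < ∑ j, 1 / H j) →
      ∀ x : EuclideanSpace ℝ (Fin p), ∃ A : Set Ω, MeasurableSet A ∧ 0 < P A ∧
        ∀ ω ∈ A, ((dimH (levelSet Y x ω) : ENNReal) : EReal) = ((levelDim H p : ℝ) : EReal)) := by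
  refine ⟨fun hQ x hx => ae_levelSet_eq_empty hH_pos hH_le hX hD1 hY hcont hQ hx, fun hQ x => ?_⟩
  obtain ⟨A, hAm, hAP, hA⟩ :=
    exists_prob_levelDim_le_dimH hH_pos hH_mono hX hD1 hD2 hY hcont hQ x
  have hU := ae_dimH_levelSet_le hH_pos hH_le hH_mono hX hD1 hY hcont hQ x
  -- Removing a measurable null set from `A` turns the almost sure bounds into bounds at every point
  -- of the event.
  obtain ⟨B, hB, hBm, hB0⟩ := exists_measurable_superset_of_null (ae_iff.1 (hA.and hU))
  refine ⟨A \ B, hAm.diff hBm, by rwa [measure_sdiff_null hB0], fun ω hω => ?_⟩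
  have hω' : (ω ∈ A → ENNReal.ofReal (levelDim H p) ≤ dimH (levelSet Y x ω)) ∧
      dimH (levelSet Y x ω) ≤ ENNReal.ofReal (levelDim H p) := by
    by_contra hn
    exact hω.2 (hB hn)
  rw [le_antisymm hω'.2 (hω'.1 hω.1), EReal.coe_ennreal_ofReal,
    max_eq_left (levelDim_pos hH_pos hH_mono hQ).le]
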